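/- Let $\alpha\in(0,1)$, $b\in(0,1]$, $T>0$. For $c\in(0,2^{\alpha-1})$ put $f(x)=c\,x^{\alpha-1}$. For $n\in\mathbb N$ let $\xi^{(n)}_1,\dots,\xi^{(n)}_{\lfloor nT\rfloor}$ be $\{0,1\}$-valued random variables with $$P\big(\xi^{(n)}_{i_0}=1,\dots,\xi^{(n)}_{i_k}=1\big)=b\,f(\lfloor nT\rfloor)\prod_{j=1}^{k}f(i_j-i_{j-1})\qquad(1\le i_0<\dots<i_k\le\lfloor nT\rfloor,\ k\ge 0)$$ (a generalized Bernoulli process). A process $\{X_t;\,t\in[0,T]\}$ is called a Mittag-Leffler process $\mathrm{ML}(\alpha,b,T)$ if, for some such $c$, the finite-dimensional distributions on $[0,T]$ of $n^{-\alpha}\sum_{1\le i\le \lfloor nt\rfloor}\xi^{(n)}_i$ converge, as $n\to\infty$, to those of $c\,\Gamma(\alpha)X_t$. **Proposition.** Let $X$ be an $\mathrm{ML}(\alpha,b,T)$ process and let $\nabla X_t=X_t-X_{t-d}$, $d>0$. Every $X_t$, $t\in[0,T]$, has finite moments of all orders, and the following hold, where $a\sim a'$ means $a/a'\to1$. (i)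 If $d\le t$, $s\le T$ and $s-t>d$, then $$\mathrm E(\nabla X_t\nabla X_s)=\frac{bT^{\alpha-1}}{\Gamma(\alpha)\Gamma(\alpha+2)}\big((s-t+d)^{\alpha+1}-2(s-t)^{\alpha+1}+(s-t-d)^{\alpha+1}\big).$$ For fixed $0<t<s\le T$, as $d\downarrow0$, $$\mathrm E(\nabla X_t\nabla X_s)\sim d^2\,\frac{bT^{\alpha-1}}{\Gamma(\alpha)^2}(s-t)^{\alpha-1},\qquad \mathrm{cov}(\nabla X_t,\nabla X_s)\sim d^2\,\frac{bT^{\alpha-1}}{\Gamma(\alpha)^2}\big((s-t)^{\alpha-1}-bT^{\alpha-1}\big),$$ $$\mathrm{corr}(\nabla X_t,\nabla X_s)\sim\frac{(s-t)^{\alpha-1}-bT^{\alpha-1}}{\frac{2}{\alpha(\alpha+1)}d^{\alpha-1}-bT^{\alpha-1}}.$$ (ii) For fixed $d>0$, as $s-t\downarrow0$ with $d\le t<s\le T$, $$\mathrm{corr}(\nabla X_t,\nabla X_s)\sim1-c'(s-t)^{\alpha+1},\qquad c'=\frac{2bT^{\alpha-1}}{\Gamma(\alpha)\Gamma(\alpha+2)\,\mathrm{var}(\nabla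 X_t)},$$ and more precisely $1-\mathrm{corr}(\nabla X_t,\nabla X_s)\sim c'(s-t)^{\alpha+1}$. (iii) For all $m\ge1$, $0<t_1<\dots<t_m\le T$ and integers $k_1,\dots,k_m\ge1$, $$\lim_{d\downarrow0}\frac{\mathrm E\big(\prod_{i=1}^m(\nabla X_{t_i})^{k_i}\big)}{\prod_{i=1}^m\mathrm E\big((\nabla X_{t_i})^{k_i}\big)}=\prod_{i=2}^m\frac{(t_i-t_{i-1})^{\alpha-1}}{bT^{\alpha-1}}.$$ -/

import Mathlib

open MeasureTheory ProbabilityTheory Filter Topology Asymptotics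

/-- `ξ 1, …, ξ N` is, under `P`, a generalized Bernoulli process of length `N` with parameters
`b` and `f`: the variables are binary and, for `1 ≤ i₀ < i₁ < ⋯ < iₖ ≤ N`,
`P(ξ_{i₀} = 1, …, ξ_{iₖ} = 1) = b f(N) ∏_{j=1}^{k} f(i_j - i_{j-1})`.
By inclusion-exclusion these probabilities determine the joint law of `ξ 1, …, ξ N`. -/
structure IsGBP {Ω : Type*} [MeasurableSpace Ω] (P : Measure Ω) (N : ℕ) (b : ℝ) (f : ℕ → ℝ)
    (ξ : ℕ → Ω → ℝ) : Prop where
  measurable : ∀ i ∈ Finset.Icc 1 N, Measurable (ξ i)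
  binary : ∀ i ∈ Finset.Icc 1 N, ∀ ω, ξ i ω = 0 ∨ ξ i ω = 1
  prob_ones : ∀ (k : ℕ) (i : Fin (k + 1) → ℕ), StrictMono i → (∀ j, i j ∈ Finset.Icc 1 N) →
    P.real {ω | ∀ j, ξ (i j) ω = 1} = b * f N * ∏ j : Fin k, f (i j.succ - i j.castSucc)

/-- The scaled random walk `n^{-α} ∑_{1 ≤ i ≤ ⌊n t⌋} ξ i` at time `t ≥ 0`. -/
noncomputable def scaledWalk {Ω : Type*} (α : ℝ) (n : ℕ) (ξ : ℕ → Ω → ℝ) (t : ℝ) (ω : Ω) : ℝ :=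
  (∑ i ∈ Finset.Icc 1 ⌊(n : ℝ) * t⌋₊, ξ i ω) / (n : ℝ) ^ α

/-- `{X t; t ∈ [0, T]}` is a Mittag-Leffler process ML(α, b, T): for some `c ∈ (0, 2^{α-1})`,
`c Γ(α) X` is the limit, in the sense of finite-dimensional distributions on `[0, T]`, of the scaled
random walks driven by generalized Bernoulli processes of length `⌊n T⌋` with parameters `b` and
`f(x) = c x^{α-1}`. The Bernoulli processes for different `n` may live on different probability
spaces. No path regularity is required of `X`: only its finite-dimensional laws matter. -/
def IsMittagLefflerProcess {Ω : Type*} [MeasurableSpace Ω] (P : Measure Ω) [IsProbabilityMeasure P]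
    (α b T : ℝ) (X : ℝ → Ω → ℝ) : Prop :=
  ∃ c : ℝ, 0 < c ∧ c < (2 : ℝ) ^ (α - 1) ∧
    ∃ (S : ℕ → Type) (_ : ∀ n, MeasurableSpace (S n)) (Q : ∀ n, Measure (S n))
      (_ : ∀ n, IsProbabilityMeasure (Q n)) (ξ : ∀ n, ℕ → S n → ℝ),
      (∀ n, IsGBP (Q n) ⌊(n : ℝ) * T⌋₊ b (fun x : ℕ => c * (x : ℝ) ^ (α - 1)) (ξ n)) ∧
      ∀ (m : ℕ) (t : Fin m → ℝ), (∀ j, t j ∈ Set.Icc 0 T) →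
        TendstoInDistribution (fun n ω j => scaledWalk α n (ξ n) (t j) ω) atTop
          (fun ω j => c * Real.Gamma α * X (t j) ω) Q P

/-- The increment `∇X_t = X_t - X_{t-d}`. -/
def increment {Ω : Type*} (X : ℝ → Ω → ℝ) (d t : ℝ) (ω : Ω) : ℝ := X t ω - X (t - d) ω

/-- The correlation coefficient of two square integrable random variables. -/
noncomputable def correlation {Ω : Type*} [MeasurableSpace Ω] (P : Measure Ω) (Y Z : Ω → ℝ) : ℝ :=
  covariance Y Z P / (√(variance Y P) * √(variance Z P))

/-! The whole argument is a computation of moments for the discrete process, followed by a passage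
to the limit.

The prescribed probabilities have a renewal form: if the indices of `B` lie to the left of those of
`A`, the probability of ones on `B ∪ A` is the product of the two separate probabilities times
`f(gap) / (b f(N))`, where the gap runs from the last index of `B` to the first of `A`
(`integral_prod_union`). As the variables are binary, a power of a block count expands into products
over index sets. Mixed moments of counts in consecutive blocks are therefore the products of the
single moments, up to factors lying between the extreme values of `f(gap) / (b f(N))`
(`integral_prod_sum_pow_mem_Icc`).

Moments survive the limit because all moments of the scaled walk at time `T` are bounded
(`exists_integral_scaledWalk_pow_le`) and the walk is nondecreasing in time. Since `f` is a power,
the comparison becomes one between mixed moments of increments of `X`, with factors `gap ^ (α - 1) /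
(b T ^ (α - 1))` (`integral_prod_increments_mem_Icc`). When the intervals shrink, the upper and
lower factors merge; this is (iii).

For (i) and (ii) only two exact formulas are needed: increments have mean proportional to their
length, and `E (X_t - X_s)² = 2 K |t - s| ^ (α + 1)` with `K = b T ^ (α - 1) / (Γ(α) Γ(α + 2))`
(`integral_sub_sq`). Polarisation yields every mixed second moment, also for overlapping increments,
as a second difference of `x ^ (α + 1)`. The asymptotics are then calculus: a second difference with
step `d` is of order `d²`, and `b ≤ 1` keeps the limiting covariance constant and the variance
positive. -/

namespace IsGBP

variable {Ω : Type*} [MeasurableSpace Ω] {P : Measure Ω} {N : ℕ} {b : ℝ} {f : ℕ → ℝ}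
  {ξ : ℕ → Ω → ℝ}

/-! ### Products of the binary variables and the renewal structure. -/

lemma nonneg (h : IsGBP P N b f ξ) {i : ℕ} (hi : i ∈ Finset.Icc 1 N) (ω : Ω) : 0 ≤ ξ i ω := by
  rcases h.binary i hi ω with h | h <;> simp [h]

lemma le_one (h : IsGBP P N b f ξ) {i : ℕ} (hi : i ∈ Finset.Icc 1 N) (ω : Ω) : ξ i ω ≤ 1 := by
  rcases h.binary i hi ω with h | h <;> simp [h]

lemma measurable_sum (h : IsGBP P N b f ξ) {I : Finset ℕ} (hI : I ⊆ Finset.Icc 1 N) :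
    Measurable (fun ω => ∑ i ∈ I, ξ i ω) :=
  Finset.measurable_fun_sum _ fun i hi => h.measurable i (hI hi)

lemma measurable_prod (h : IsGBP P N b f ξ) {A : Finset ℕ} (hA : A ⊆ Finset.Icc 1 N) :
    Measurable (fun ω => ∏ i ∈ A, ξ i ω) :=
  Finset.measurable_fun_prod _ fun i hi => h.measurable i (hA hi)

lemma sum_nonneg (h : IsGBP P N b f ξ) {I : Finset ℕ} (hI : I ⊆ Finset.Icc 1 N) (ω : Ω) :
    0 ≤ ∑ i ∈ I, ξ i ω :=
  Finset.sum_nonneg fun _ hi => h.nonneg (hI hi) ω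

lemma sum_le (h : IsGBP P N b f ξ) {I : Finset ℕ} (hI : I ⊆ Finset.Icc 1 N) (ω : Ω) :
    ∑ i ∈ I, ξ i ω ≤ I.card := by
  simpa using Finset.sum_le_sum fun i (hi : i ∈ I) => h.le_one (hI hi) ω

lemma prod_eq_ite (h : IsGBP P N b f ξ) {A : Finset ℕ} (hA : A ⊆ Finset.Icc 1 N) (ω : Ω) :
    ∏ i ∈ A, ξ i ω = {ω | ∀ i ∈ A, ξ i ω = 1}.indicator 1 ω := by
  by_cases hω : ∀ i ∈ A, ξ i ω = 1
  · rw [Finset.prod_congr rfl hω]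
    simpa [Set.indicator] using hω
  · have := hω
    push Not at this
    obtain ⟨i, hi, hne⟩ := this
    rw [Finset.prod_eq_zero hi ((h.binary i (hA hi) ω).resolve_right hne)]
    simp [Set.indicator, hω]

lemma measurableSet_ones (h : IsGBP P N b f ξ) {A : Finset ℕ} (hA : A ⊆ Finset.Icc 1 N) :
    MeasurableSet {ω | ∀ i ∈ A, ξ i ω = 1} := by
  have : {ω | ∀ i ∈ A, ξ i ω = 1} = ⋂ i ∈ A, {ω | ξ i ω = 1} := by ext; simp
  rw [this]
  exact Finset.measurableSet_biInter _ fun i hi =>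
    measurableSet_eq_fun (h.measurable i (hA hi)) measurable_const

lemma integral_prod (h : IsGBP P N b f ξ) {A : Finset ℕ} (hA : A ⊆ Finset.Icc 1 N) :
    ∫ ω, ∏ i ∈ A, ξ i ω ∂P = P.real {ω | ∀ i ∈ A, ξ i ω = 1} := by
  simp_rw [h.prod_eq_ite hA]
  exact integral_indicator_one (h.measurableSet_ones hA)

lemma integrable_prod [IsProbabilityMeasure P] (h : IsGBP P N b f ξ) {A : Finset ℕ}
    (hA : A ⊆ Finset.Icc 1 N) : Integrable (fun ω => ∏ i ∈ A, ξ i ω) P := by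
  refine Integrable.of_bound (h.measurable_prod hA).aestronglyMeasurable 1 (ae_of_all _ fun ω => ?_)
  rw [h.prod_eq_ite hA, Set.indicator]
  split_ifs <;> simp

lemma integral_prod_nonneg (h : IsGBP P N b f ξ) {A : Finset ℕ} (hA : A ⊆ Finset.Icc 1 N) :
    0 ≤ ∫ ω, ∏ i ∈ A, ξ i ω ∂P := by
  rw [h.integral_prod hA]; exact measureReal_nonneg

lemma integral_prod_image (h : IsGBP P N b f ξ) {k : ℕ} {i : Fin (k + 1) → ℕ} (hi : StrictMono i)
    (hN : ∀ j, i j ∈ Finset.Icc 1 N) :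
    ∫ ω, ∏ x ∈ Finset.univ.image i, ξ x ω ∂P
      = b * f N * ∏ j : Fin k, f (i j.succ - i j.castSucc) := by
  rw [h.integral_prod (by intro x hx; obtain ⟨j, -, rfl⟩ := Finset.mem_image.1 hx; exact hN j),
    ← h.prob_ones k i hi hN]
  simp

lemma integral_singleton (h : IsGBP P N b f ξ) {x : ℕ} (hx : x ∈ Finset.Icc 1 N) :
    ∫ ω, ξ x ω ∂P = b * f N := by
  have := h.integral_prod_image (k := 0) (i := fun _ => x) (fun p q hpq => by omega) fun _ => hx
  simpa using this

/-- Adding a new smallest index `x` multiplies the probability by `f (y - x)`, where `y` is the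
smallest of the old indices. -/
lemma integral_prod_insert (h : IsGBP P N b f ξ) {A : Finset ℕ} (hA : A ⊆ Finset.Icc 1 N) {x y : ℕ}
    (hx : x ∈ Finset.Icc 1 N) (hxy : x < y) (hy : y ∈ A) (hmin : ∀ z ∈ A, y ≤ z) :
    ∫ ω, ∏ i ∈ insert x A, ξ i ω ∂P = f (y - x) * ∫ ω, ∏ i ∈ A, ξ i ω ∂P := by
  obtain ⟨k, hk⟩ : ∃ k, A.card = k + 1 :=
    ⟨A.card - 1, by have := Finset.card_pos.2 ⟨y, hy⟩; omega⟩
  set i := A.orderEmbOfFin hk with hi_def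
  have himg : Finset.univ.image i = A := Finset.image_orderEmbOfFin_univ A hk
  have hi0 : i 0 = y := by
    have h0 := hmin _ (A.orderEmbOfFin_mem hk 0)
    obtain ⟨j, -, hj⟩ := Finset.mem_image.1 (himg ▸ hy)
    have : i 0 ≤ i j := i.monotone (Fin.zero_le j)
    rw [hj] at this
    exact le_antisymm this h0
  have hmono : StrictMono (Fin.cons x i : Fin (k + 2) → ℕ) := by
    rw [Fin.strictMono_iff_lt_succ]
    intro j
    refine Fin.cases ?_ (fun j => ?_) j
    · simp [hi0, hxy]
    · simp
  have hmem : ∀ j, (Fin.cons x i : Fin (k + 2) → ℕ) j ∈ Finset.Icc 1 N := by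
    intro j
    refine Fin.cases ?_ (fun j => ?_) j
    · simpa using hx
    · simpa using hA (A.orderEmbOfFin_mem hk j)
  have himg' : Finset.univ.image (Fin.cons x i : Fin (k + 2) → ℕ) = insert x A := by
    rw [← himg]
    ext z
    simp [Fin.exists_fin_succ, eq_comm]
  have e1 := h.integral_prod_image hmono hmem
  have e2 := h.integral_prod_image i.strictMono fun j => hA (A.orderEmbOfFin_mem hk j)
  rw [himg'] at e1
  rw [himg] at e2
  rw [e1, e2, Fin.prod_univ_succ]
  simp only [Fin.cons_succ, Fin.castSucc_zero, Fin.cons_zero, ← Fin.succ_castSucc, hi0]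
  ring

/-- The renewal property: the law of a block of indices to the right of `y` depends on the block to
the left of `x` only through the gap `y - x`. -/
lemma integral_prod_union (h : IsGBP P N b f ξ) {A : Finset ℕ} (hA : A ⊆ Finset.Icc 1 N) {y : ℕ}
    (hy : y ∈ A) (hmin : ∀ z ∈ A, y ≤ z) (B : Finset ℕ) (hB : B ⊆ Finset.Icc 1 N) {x : ℕ}
    (hx : x ∈ B) (hmax : ∀ z ∈ B, z ≤ x) (hxy : x < y) :
    (∫ ω, ∏ i ∈ B ∪ A, ξ i ω ∂P) * (b * f N)
      = f (y - x) * (∫ ω, ∏ i ∈ B, ξ i ω ∂P) * ∫ ω, ∏ i ∈ A, ξ i ω ∂P := by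
  -- `B` is built from right to left: each new minimum contributes the same factor to both sides,
  -- until only the case `B = {x}` is left. Multiplying by `b * f N` instead of dividing keeps the
  -- identity valid when that number vanishes.
  induction B using Finset.induction_on_min with
  | empty => simp at hx
  | insert a B hmin' ih =>
    have haN : a ∈ Finset.Icc 1 N := hB (Finset.mem_insert_self _ _)
    have hBN : B ⊆ Finset.Icc 1 N := fun z hz => hB (Finset.mem_insert_of_mem hz)
    rcases B.eq_empty_or_nonempty with rfl | hne
    · obtain rfl : x = a := by simpa using hx
      rw [Finset.insert_union, Finset.empty_union, h.integral_prod_insert hA haN hxy hy hmin]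
      simp only [insert_empty_eq, Finset.prod_singleton, h.integral_singleton haN]
      ring
    · have hxB : x ∈ B := by
        refine (Finset.mem_insert.1 hx).resolve_left ?_
        rintro rfl
        obtain ⟨z, hz⟩ := hne
        exact absurd (hmin' z hz) (not_lt.2 (hmax z (Finset.mem_insert_of_mem hz)))
      have key := ih hBN hxB (fun z hz => hmax z (Finset.mem_insert_of_mem hz))
      have hm := B.min'_mem hne
      rw [Finset.insert_union, h.integral_prod_insert (Finset.union_subset hBN hA) haN
        (hmin' _ hm) (Finset.mem_union_left _ hm), h.integral_prod_insert hBN haN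
        (hmin' _ hm) hm fun z hz => B.min'_le z hz, mul_assoc, key]
      · ring
      · intro z hz
        rcases Finset.mem_union.1 hz with hz | hz
        · exact B.min'_le z hz
        · exact (hmax _ (Finset.mem_insert_of_mem hm)).trans (hxy.le.trans (hmin z hz))

/-- The joint probability of several consecutive blocks of indices. -/
lemma exists_integral_prod_blocks (h : IsGBP P N b f ξ) (hb : b * f N ≠ 0) (m : ℕ)
    (A : Fin (m + 1) → Finset ℕ) (hA : ∀ a, A a ⊆ Finset.Icc 1 N) (hne : ∀ a, (A a).Nonempty)
    (hlt : ∀ a a', a < a' → ∀ x ∈ A a, ∀ y ∈ A a', x < y) :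
    ∃ x y : Fin m → ℕ, (∀ a, x a ∈ A a.castSucc ∧ y a ∈ A a.succ) ∧
      ∫ ω, ∏ a, ∏ i ∈ A a, ξ i ω ∂P
        = (∏ a, f (y a - x a) / (b * f N)) * ∏ a, ∫ ω, ∏ i ∈ A a, ξ i ω ∂P := by
  have hdisj : (Set.univ : Set (Fin (m + 1))).PairwiseDisjoint A := by
    intro a _ a' _ haa'
    rw [Function.onFun, Finset.disjoint_left]
    intro z hz hz'
    rcases lt_or_gt_of_ne haa' with hl | hl
    · exact lt_irrefl _ (hlt _ _ hl z hz z hz')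
    · exact lt_irrefl _ (hlt _ _ hl z hz' z hz)
  induction m with
  | zero => exact ⟨Fin.elim0, Fin.elim0, fun a => a.elim0, by simp⟩
  | succ m ih =>
    obtain ⟨x, y, hxy, e⟩ := ih (fun a => A a.castSucc) (fun a => hA _) (fun a => hne _)
      (fun a a' haa' => hlt _ _ (by simpa using haa'))
      (fun a _ a' _ haa' => hdisj trivial trivial (by simpa using haa'))
    set B : Finset ℕ := Finset.univ.biUnion fun a : Fin (m + 1) => A a.castSucc with hB
    set x' := (A (Fin.last m).castSucc).max' (hne _)
    set y' := (A (Fin.last (m + 1))).min' (hne _)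
    have hx' : x' ∈ A (Fin.last m).castSucc := Finset.max'_mem _ _
    have hy' : y' ∈ A (Fin.last (m + 1)) := Finset.min'_mem _ _
    have hprod : ∀ ω, ∏ a : Fin (m + 1), ∏ i ∈ A a.castSucc, ξ i ω = ∏ i ∈ B, ξ i ω := by
      intro ω
      rw [hB, Finset.prod_biUnion]
      exact fun a _ a' _ haa' => hdisj trivial trivial (by simpa using haa')
    have hBA : Disjoint B (A (Fin.last (m + 1))) := by
      rw [hB, Finset.disjoint_biUnion_left]
      exact fun a _ => hdisj trivial trivial (Fin.castSucc_lt_last a).ne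
    have key := h.integral_prod_union (hA _) hy' (fun z hz => Finset.min'_le _ z hz) B
      (Finset.biUnion_subset.2 fun a _ => hA _) (x := x')
      (Finset.mem_biUnion.2 ⟨_, Finset.mem_univ _, hx'⟩) (by
        intro z hz
        obtain ⟨a, -, hza⟩ := Finset.mem_biUnion.1 hz
        rcases (Fin.le_last a).eq_or_lt with rfl | hl
        · exact Finset.le_max' _ z hza
        · exact (hlt _ _ (by simpa using hl) z hza x' hx').le)
      (hlt _ _ (Fin.castSucc_lt_last _) _ hx' _ hy')
    refine ⟨Fin.snoc x x', Fin.snoc y y', fun a => ?_, ?_⟩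
    · refine Fin.lastCases ?_ (fun a => ?_) a
      · simpa using ⟨hx', hy'⟩
      · simpa using hxy a
    · simp_rw [Fin.prod_univ_castSucc (n := m + 1), hprod]
      rw [Fin.prod_univ_castSucc (n := m)]
      simp_rw [← Finset.prod_union hBA]
      simp only [hprod] at e
      simp only [Fin.snoc_castSucc, Fin.snoc_last]
      rw [eq_div_of_mul_eq hb key, e]
      ring

/-! ### Moments of the counts of successes. -/

/-- Binary variables are idempotent, so repeated indices count once. This is what brings powers of
sums within reach of the formula for distinct indices. -/
lemma prod_tuple (h : IsGBP P N b f ξ) {κ : Type*} [Fintype κ] {i : κ → ℕ}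
    (hi : ∀ j, i j ∈ Finset.Icc 1 N) (ω : Ω) :
    ∏ j, ξ (i j) ω = ∏ x ∈ Finset.univ.image i, ξ x ω := by
  by_cases hω : ∀ j, ξ (i j) ω = 1
  · rw [Finset.prod_congr rfl fun j _ => hω j, Finset.prod_eq_one, Finset.prod_eq_one]
    · intro x hx
      obtain ⟨j, -, rfl⟩ := Finset.mem_image.1 hx
      exact hω j
    · simp
  · push Not at hω
    obtain ⟨j, hj⟩ := hω
    have h0 := (h.binary _ (hi j) ω).resolve_right hj
    rw [Finset.prod_eq_zero (Finset.mem_univ j) h0,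
      Finset.prod_eq_zero (Finset.mem_image_of_mem i (Finset.mem_univ j)) h0]

lemma sum_pow_eq (h : IsGBP P N b f ξ) {I : Finset ℕ} (hI : I ⊆ Finset.Icc 1 N) (k : ℕ) (ω : Ω) :
    (∑ i ∈ I, ξ i ω) ^ k = ∑ g ∈ Fintype.piFinset fun _ : Fin k => I,
      ∏ x ∈ Finset.univ.image g, ξ x ω := by
  have := Finset.prod_univ_sum (fun _ : Fin k => I) (fun _ i => ξ i ω)
  rw [Finset.prod_const, Finset.card_univ, Fintype.card_fin] at this
  rw [this]
  refine Finset.sum_congr rfl fun g hg => h.prod_tuple (fun j => ?_) ω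
  exact hI (Fintype.mem_piFinset.1 hg j)

lemma image_subset_of_mem_piFinset {k : ℕ} {I : Finset ℕ} {g : Fin k → ℕ}
    (hg : g ∈ Fintype.piFinset fun _ : Fin k => I) : Finset.univ.image g ⊆ I := by
  intro x hx
  obtain ⟨j, -, rfl⟩ := Finset.mem_image.1 hx
  exact Fintype.mem_piFinset.1 hg j

/-- Mixed moments of the numbers of successes in consecutive blocks compare with the products of
the moments of the single blocks. -/
lemma integral_prod_sum_pow_mem_Icc [IsProbabilityMeasure P] (h : IsGBP P N b f ξ)
    (hb : 0 < b * f N) (m : ℕ) (I : Fin (m + 1) → Finset ℕ) (hI : ∀ a, I a ⊆ Finset.Icc 1 N)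
    (hlt : ∀ a a', a < a' → ∀ x ∈ I a, ∀ y ∈ I a', x < y) (k : Fin (m + 1) → ℕ)
    (hk : ∀ a, 1 ≤ k a) (lo hi : Fin m → ℝ) (hlo : ∀ a, 0 ≤ lo a)
    (hf : ∀ a, ∀ x ∈ I a.castSucc, ∀ y ∈ I a.succ, f (y - x) ∈ Set.Icc (lo a) (hi a)) :
    ∫ ω, ∏ a, (∑ i ∈ I a, ξ i ω) ^ k a ∂P ∈
      Set.Icc ((∏ a, lo a / (b * f N)) * ∏ a, ∫ ω, (∑ i ∈ I a, ξ i ω) ^ k a ∂P)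
        ((∏ a, hi a / (b * f N)) * ∏ a, ∫ ω, (∑ i ∈ I a, ξ i ω) ^ k a ∂P) := by
  set T : ∀ a, Finset (Fin (k a) → ℕ) := fun a => Fintype.piFinset fun _ : Fin (k a) => I a
  have hTsub : ∀ a, ∀ g ∈ T a, Finset.univ.image g ⊆ Finset.Icc 1 N := fun a g hg =>
    (image_subset_of_mem_piFinset hg).trans (hI a)
  have e1 : ∀ a, ∫ ω, (∑ i ∈ I a, ξ i ω) ^ k a ∂P
      = ∑ g ∈ T a, ∫ ω, ∏ x ∈ Finset.univ.image g, ξ x ω ∂P := by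
    intro a
    simp_rw [h.sum_pow_eq (hI a)]
    exact integral_finsetSum _ fun g hg => h.integrable_prod (hTsub a g hg)
  -- The gap endpoints depend on the choice of tuples, but always lie in neighbouring blocks, where
  -- `hf` applies. The exponents are at least one, so that no tuple has an empty image.
  have hblock : ∀ G ∈ Fintype.piFinset T,
      ∃ x y : Fin m → ℕ, (∀ a, x a ∈ I a.castSucc ∧ y a ∈ I a.succ) ∧
      ∫ ω, ∏ a, ∏ i ∈ Finset.univ.image (G a), ξ i ω ∂P
        = (∏ a, f (y a - x a) / (b * f N)) *
          ∏ a, ∫ ω, ∏ i ∈ Finset.univ.image (G a), ξ i ω ∂P := by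
    intro G hG
    have hG' := fun a => image_subset_of_mem_piFinset (Fintype.mem_piFinset.1 hG a)
    obtain ⟨x, y, hxy, e⟩ := h.exists_integral_prod_blocks hb.ne' m
      (fun a => Finset.univ.image (G a)) (fun a => (hG' a).trans (hI a))
      (fun a => ⟨_, Finset.mem_image_of_mem _ (Finset.mem_univ ⟨0, hk a⟩)⟩)
      (fun a a' haa' x hx y hy => hlt a a' haa' x (hG' a hx) y (hG' a' hy))
    exact ⟨x, y, fun a => ⟨hG' _ (hxy a).1, hG' _ (hxy a).2⟩, e⟩
  have e2 : ∫ ω, ∏ a, (∑ i ∈ I a, ξ i ω) ^ k a ∂P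
      = ∑ G ∈ Fintype.piFinset T, ∫ ω, ∏ a, ∏ x ∈ Finset.univ.image (G a), ξ x ω ∂P := by
    simp_rw [h.sum_pow_eq (hI _), Finset.prod_univ_sum]
    refine integral_finsetSum _ fun G hG => ?_
    have hG' := fun a => hTsub a _ (Fintype.mem_piFinset.1 hG a)
    refine Integrable.of_bound (Finset.measurable_fun_prod _ fun a _ =>
      h.measurable_prod (hG' a)).aestronglyMeasurable 1 (ae_of_all _ fun ω => ?_)
    rw [Real.norm_eq_abs, Finset.abs_prod]
    refine Finset.prod_le_one (fun _ _ => abs_nonneg _) fun a _ => ?_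
    rw [h.prod_eq_ite (hG' a), Set.indicator]
    split_ifs <;> simp
  have hnn : ∀ G ∈ Fintype.piFinset T,
      0 ≤ ∏ a, ∫ ω, ∏ i ∈ Finset.univ.image (G a), ξ i ω ∂P := fun G hG =>
    Finset.prod_nonneg fun a _ =>
      h.integral_prod_nonneg (hTsub a _ (Fintype.mem_piFinset.1 hG a))
  simp_rw [e1, Finset.prod_univ_sum]
  rw [e2, Finset.mul_sum, Finset.mul_sum]
  constructor
  · refine Finset.sum_le_sum fun G hG => ?_
    obtain ⟨x, y, hxy, e⟩ := hblock G hG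
    rw [e]
    refine mul_le_mul_of_nonneg_right (Finset.prod_le_prod (fun a _ => ?_) fun a _ => ?_) (hnn G hG)
    · exact div_nonneg (hlo a) hb.le
    · exact div_le_div_of_nonneg_right (hf a _ (hxy a).1 _ (hxy a).2).1 hb.le
  · refine Finset.sum_le_sum fun G hG => ?_
    obtain ⟨x, y, hxy, e⟩ := hblock G hG
    rw [e]
    have := fun a => hf a _ (hxy a).1 _ (hxy a).2
    refine mul_le_mul_of_nonneg_right (Finset.prod_le_prod (fun a _ => ?_) fun a _ => ?_) (hnn G hG)
    · exact div_nonneg ((hlo a).trans (this a).1) hb.le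
    · exact div_le_div_of_nonneg_right (this a).2 hb.le

/-- The product over `A` is one exactly when `A` lies inside the random set of successes, so the sum
counts the `k`-subsets of that set. Binomial moments are easier to bound than powers, as no index
repeats. -/
lemma sum_powersetCard_prod (h : IsGBP P N b f ξ) (k : ℕ) (ω : Ω) :
    ∃ s : ℕ, ∑ i ∈ Finset.Icc 1 N, ξ i ω = s ∧
      ∑ A ∈ (Finset.Icc 1 N).powersetCard k, ∏ i ∈ A, ξ i ω = s.choose k := by
  classical
  set R := (Finset.Icc 1 N).filter fun i => ξ i ω = 1
  refine ⟨R.card, ?_, ?_⟩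
  · rw [← Finset.sum_boole]
    refine Finset.sum_congr rfl fun i hi => ?_
    rcases h.binary i hi ω with h | h <;> simp [h]
  · rw [← Finset.card_powersetCard]
    have : R.powersetCard k = ((Finset.Icc 1 N).powersetCard k).filter
        fun A => ∀ i ∈ A, ξ i ω = 1 := by
      ext A
      simp only [Finset.mem_powersetCard, Finset.mem_filter, R, Finset.subset_iff]
      grind
    rw [this, ← Finset.sum_boole]
    refine Finset.sum_congr rfl fun A hA => ?_
    rw [h.prod_eq_ite (Finset.mem_powersetCard.1 hA).1]
    simp [Set.indicator]

/-- Remove the smallest index from each set: by the renewal property it carries a factor `f (gap)`,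
and for a fixed remainder the gaps are distinct elements of `1, …, N`. -/
lemma sum_integral_powersetCard_succ_le (h : IsGBP P N b f ξ) (hf : ∀ n, 0 ≤ f n) (k : ℕ) :
    ∑ A ∈ (Finset.Icc 1 N).powersetCard (k + 2), ∫ ω, ∏ i ∈ A, ξ i ω ∂P
      ≤ (∑ g ∈ Finset.Icc 1 N, f g) *
        ∑ A ∈ (Finset.Icc 1 N).powersetCard (k + 1), ∫ ω, ∏ i ∈ A, ξ i ω ∂P := by
  classical
  have hmin : ∀ A ∈ (Finset.Icc 1 N).powersetCard (k + 1), ∃ y ∈ A, ∀ z ∈ A, y ≤ z := by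
    intro A hA
    have hne : A.Nonempty := Finset.card_pos.1 (by rw [(Finset.mem_powersetCard.1 hA).2]; omega)
    exact ⟨A.min' hne, A.min'_mem hne, fun z hz => A.min'_le z hz⟩
  choose! μ hμ hμle using hmin
  rw [Finset.mul_sum]
  have step : ∀ A ∈ (Finset.Icc 1 N).powersetCard (k + 1),
      ∑ x ∈ (Finset.Icc 1 N).filter (· < μ A), ∫ ω, ∏ i ∈ insert x A, ξ i ω ∂P
        ≤ (∑ g ∈ Finset.Icc 1 N, f g) * ∫ ω, ∏ i ∈ A, ξ i ω ∂P := by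
    intro A hA
    have hAN := (Finset.mem_powersetCard.1 hA).1
    have hμN := Finset.mem_Icc.1 (hAN (hμ A hA))
    rw [Finset.sum_congr rfl fun x hx => h.integral_prod_insert hAN (Finset.mem_filter.1 hx).1
      (Finset.mem_filter.1 hx).2 (hμ A hA) (hμle A hA), ← Finset.sum_mul]
    refine mul_le_mul_of_nonneg_right ?_ (h.integral_prod_nonneg hAN)
    rw [← Finset.sum_image (f := f) (g := fun x => μ A - x)]
    · refine Finset.sum_le_sum_of_subset_of_nonneg (fun g hg => ?_) fun g _ _ => hf g
      obtain ⟨x, hx, rfl⟩ := Finset.mem_image.1 hg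
      simp only [Finset.mem_filter, Finset.mem_Icc] at hx ⊢
      omega
    · intro x hx x' hx' hxx'
      simp only [Finset.coe_filter, Set.mem_ofPred_eq] at hx hx' hxx'
      omega
  refine le_trans ?_ (Finset.sum_le_sum step)
  rw [Finset.sum_sigma']
  have hmin' : ∀ A ∈ (Finset.Icc 1 N).powersetCard (k + 2), ∃ y ∈ A, ∀ z ∈ A, y ≤ z := by
    intro A hA
    have hne : A.Nonempty := Finset.card_pos.1 (by rw [(Finset.mem_powersetCard.1 hA).2]; omega)
    exact ⟨A.min' hne, A.min'_mem hne, fun z hz => A.min'_le z hz⟩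
  choose! ν hν hνle using hmin'
  have hins : ∀ A ∈ (Finset.Icc 1 N).powersetCard (k + 2), insert (ν A) (A.erase (ν A)) = A :=
    fun A hA => Finset.insert_erase (hν A hA)
  rw [← Finset.sum_congr rfl fun A hA => congrArg (fun A => ∫ ω, ∏ i ∈ A, ξ i ω ∂P) (hins A hA),
    ← Finset.sum_image (g := fun A => (⟨A.erase (ν A), ν A⟩ : (_ : Finset ℕ) × ℕ))
      (f := fun p => ∫ ω, ∏ i ∈ insert p.2 p.1, ξ i ω ∂P)]
  · refine Finset.sum_le_sum_of_subset_of_nonneg (fun p hp => ?_) fun p hp _ => ?_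
    · obtain ⟨A, hA, rfl⟩ := Finset.mem_image.1 hp
      have hA' := Finset.mem_powersetCard.1 hA
      have hE : A.erase (ν A) ∈ (Finset.Icc 1 N).powersetCard (k + 1) := by
        refine Finset.mem_powersetCard.2 ⟨(Finset.erase_subset _ _).trans hA'.1, ?_⟩
        rw [Finset.card_erase_of_mem (hν A hA), hA'.2]
        rfl
      refine Finset.mem_sigma.2 ⟨hE, Finset.mem_filter.2 ⟨hA'.1 (hν A hA), ?_⟩⟩
      have := Finset.mem_erase.1 (hμ _ hE)
      exact lt_of_le_of_ne (hνle A hA _ this.2) this.1.symm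
    · obtain ⟨hp1, hp2⟩ := Finset.mem_sigma.1 hp
      exact h.integral_prod_nonneg (Finset.insert_subset (Finset.mem_filter.1 hp2).1
        (Finset.mem_powersetCard.1 hp1).1)
  · intro A hA A' hA' hAA'
    simp only [Sigma.mk.injEq, heq_eq_eq] at hAA'
    rw [← hins A hA, ← hins A' hA', hAA'.1, hAA'.2]

lemma integral_sum_eq [IsProbabilityMeasure P] (h : IsGBP P N b f ξ) {I : Finset ℕ}
    (hI : I ⊆ Finset.Icc 1 N) : ∫ ω, ∑ i ∈ I, ξ i ω ∂P = I.card * (b * f N) := by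
  rw [integral_finsetSum _ fun i hi => by
    simpa using h.integrable_prod (Finset.singleton_subset_iff.2 (hI hi)),
    Finset.sum_congr rfl fun i hi => h.integral_singleton (hI hi)]
  simp

lemma sum_integral_powersetCard_le [IsProbabilityMeasure P] (h : IsGBP P N b f ξ)
    (hf : ∀ n, 0 ≤ f n) (k : ℕ) :
    ∑ A ∈ (Finset.Icc 1 N).powersetCard (k + 1), ∫ ω, ∏ i ∈ A, ξ i ω ∂P
      ≤ N * (b * f N) * (∑ g ∈ Finset.Icc 1 N, f g) ^ k := by
  induction k with
  | zero =>
    rw [zero_add, Finset.powersetCard_one, Finset.sum_map]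
    simp only [Function.Embedding.coeFn_mk, Finset.prod_singleton]
    rw [Finset.sum_congr rfl fun i hi => h.integral_singleton hi]
    simp
  | succ k ih =>
    refine (h.sum_integral_powersetCard_succ_le hf k).trans ?_
    refine (mul_le_mul_of_nonneg_left ih (Finset.sum_nonneg fun g _ => hf g)).trans_eq ?_
    ring

/-- Moments of the total number of successes. -/
lemma integral_sum_pow_le [IsProbabilityMeasure P] (h : IsGBP P N b f ξ)
    (hf : ∀ n, 0 ≤ f n) (k : ℕ) :
    ∫ ω, (∑ i ∈ Finset.Icc 1 N, ξ i ω) ^ (k + 1) ∂P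
      ≤ 2 ^ (k + 1) * (k + 1).factorial * (N * (b * f N) * (∑ g ∈ Finset.Icc 1 N, f g) ^ k)
        + (2 * (k + 1)) ^ (k + 1) := by
  have hint : Integrable (fun ω => ∑ A ∈ (Finset.Icc 1 N).powersetCard (k + 1),
      ∏ i ∈ A, ξ i ω) P :=
    integrable_finsetSum _ fun A hA => h.integrable_prod (Finset.mem_powersetCard.1 hA).1
  have hle : ∀ ω, (∑ i ∈ Finset.Icc 1 N, ξ i ω) ^ (k + 1)
      ≤ 2 ^ (k + 1) * (k + 1).factorial * (∑ A ∈ (Finset.Icc 1 N).powersetCard (k + 1),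
        ∏ i ∈ A, ξ i ω) + (2 * (k + 1)) ^ (k + 1) := by
    intro ω
    obtain ⟨s, hs, hc⟩ := h.sum_powersetCard_prod (k + 1) ω
    rw [hs, hc]
    -- For `s ≥ 2 (k + 1)` one has `s ≤ 2 (s - k)`, and `(s - k) ^ (k + 1)` is below the descending
    -- factorial; smaller `s` are absorbed by the additive constant.
    have : s ^ (k + 1) ≤ 2 ^ (k + 1) * (k + 1).factorial * s.choose (k + 1)
        + (2 * (k + 1)) ^ (k + 1) := by
      rw [mul_assoc, ← Nat.descFactorial_eq_factorial_mul_choose]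
      rcases le_total s (2 * (k + 1)) with hsk | hsk
      · exact le_add_left (Nat.pow_le_pow_left hsk _)
      · refine le_add_right ?_
        calc s ^ (k + 1) ≤ (2 * (s + 1 - (k + 1))) ^ (k + 1) := Nat.pow_le_pow_left (by omega) _
          _ = 2 ^ (k + 1) * (s + 1 - (k + 1)) ^ (k + 1) := mul_pow _ _ _
          _ ≤ _ := Nat.mul_le_mul_left _ (Nat.pow_sub_le_descFactorial s (k + 1))
    exact_mod_cast this
  refine (integral_mono_of_nonneg (ae_of_all _ fun ω => pow_nonneg
    (h.sum_nonneg le_rfl ω) _) ((hint.const_mul _).add (integrable_const _))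
    (ae_of_all _ hle)).trans ?_
  simp only [Pi.add_apply]
  rw [integral_add (hint.const_mul _) (integrable_const _), integral_const_mul,
    integral_finsetSum _ fun A hA => h.integrable_prod (Finset.mem_powersetCard.1 hA).1]
  simp only [integral_const, probReal_univ, one_smul]
  gcongr
  exact h.sum_integral_powersetCard_le hf k

/-- The second moment of the number of successes in a block of length `L`. -/
lemma integral_sum_sq [IsProbabilityMeasure P] (h : IsGBP P N b f ξ) (p L : ℕ) (hL : p + L ≤ N) :
    ∫ ω, (∑ i ∈ Finset.Ioc p (p + L), ξ i ω) ^ 2 ∂P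
      = b * f N * (L + 2 * ∑ M ∈ Finset.range L, ∑ g ∈ Finset.Icc 1 M, f g) := by
  induction L with
  | zero => simp
  | succ L ih =>
    have hq : p + (L + 1) ∈ Finset.Icc 1 N := by simp; omega
    have hI : Finset.Ioc p (p + L) ⊆ Finset.Icc 1 N := by
      intro x hx; simp only [Finset.mem_Ioc, Finset.mem_Icc] at hx ⊢; omega
    -- Adding one index to the block adds the cross terms with it and its square, which equals the
    -- variable itself.
    have e : ∀ ω, (∑ i ∈ Finset.Ioc p (p + (L + 1)), ξ i ω) ^ 2
        = (∑ i ∈ Finset.Ioc p (p + L), ξ i ω) ^ 2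
          + 2 * (∑ i ∈ Finset.Ioc p (p + L), ∏ j ∈ {i, p + (L + 1)}, ξ j ω)
          + ξ (p + (L + 1)) ω := by
      intro ω
      have h1 : ∑ i ∈ Finset.Ioc p (p + (L + 1)), ξ i ω
          = ∑ i ∈ Finset.Ioc p (p + L), ξ i ω + ξ (p + (L + 1)) ω := by
        rw [← add_assoc, Finset.sum_Ioc_succ_top (by omega)]
      have h2 : ∑ i ∈ Finset.Ioc p (p + L), ∏ j ∈ {i, p + (L + 1)}, ξ j ω
          = (∑ i ∈ Finset.Ioc p (p + L), ξ i ω) * ξ (p + (L + 1)) ω := by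
        rw [Finset.sum_mul]
        refine Finset.sum_congr rfl fun i hi => Finset.prod_pair ?_
        have := (Finset.mem_Ioc.1 hi).2
        omega
      rw [h1, h2]
      rcases h.binary _ hq ω with h0 | h0 <;> rw [h0] <;> ring
    have hpair : ∀ i ∈ Finset.Ioc p (p + L), ({i, p + (L + 1)} : Finset ℕ) ⊆ Finset.Icc 1 N := by
      intro i hi
      exact Finset.insert_subset (hI hi) (Finset.singleton_subset_iff.2 hq)
    have i1 : Integrable (fun ω => (∑ i ∈ Finset.Ioc p (p + L), ξ i ω) ^ 2) P := by
      refine Integrable.of_bound ((h.measurable_sum hI).pow_const 2).aestronglyMeasurable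
        (((Finset.Ioc p (p + L)).card : ℝ) ^ 2) (ae_of_all _ fun ω => ?_)
      rw [Real.norm_of_nonneg (sq_nonneg _)]
      exact pow_le_pow_left₀ (h.sum_nonneg hI ω) (h.sum_le hI ω) 2
    have i2 : Integrable (fun ω => 2 * ∑ i ∈ Finset.Ioc p (p + L),
        ∏ j ∈ {i, p + (L + 1)}, ξ j ω) P :=
      (integrable_finsetSum _ fun i hi => h.integrable_prod (hpair i hi)).const_mul 2
    have i3 : Integrable (ξ (p + (L + 1))) P := by
      simpa using h.integrable_prod (Finset.singleton_subset_iff.2 hq)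
    simp_rw [e]
    have i12 := integral_add (i1.add i2) i3
    simp only [Pi.add_apply] at i12
    rw [i12, integral_add i1 i2, ih (by omega), integral_const_mul,
      integral_finsetSum _ fun i hi => h.integrable_prod (hpair i hi), h.integral_singleton hq,
      Finset.sum_range_succ]
    have e2 : ∀ i ∈ Finset.Ioc p (p + L), ∫ ω, ∏ j ∈ {i, p + (L + 1)}, ξ j ω ∂P
        = f (p + (L + 1) - i) * (b * f N) := by
      intro i hi
      rw [h.integral_prod_insert (A := {p + (L + 1)}) (by simpa using hq) (hI hi)
        (y := p + (L + 1)) (by have := (Finset.mem_Ioc.1 hi).2; omega) (by simp) (by simp)]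
      simp only [Finset.prod_singleton, h.integral_singleton hq]
    -- The gaps to the new last index run exactly through `1, …, L`.
    have e3 : ∑ i ∈ Finset.Ioc p (p + L), f (p + (L + 1) - i) = ∑ g ∈ Finset.Icc 1 L, f g := by
      refine Finset.sum_nbij' (fun i => p + (L + 1) - i) (fun g => p + (L + 1) - g) ?_ ?_ ?_ ?_ ?_
      all_goals simp only [Finset.mem_Ioc, Finset.mem_Icc]
      all_goals intros
      all_goals first | omega | trivial
    rw [Finset.sum_congr rfl e2, ← Finset.sum_mul, e3]
    push_cast
    ring

end IsGBP

/-! ### Convergence of means from convergence in distribution and bounded second moments. -/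

section MomentConvergence

variable {ι : Type*} {Ω' : Type*} {S : ι → Type*} [∀ i, MeasurableSpace (S i)]
  {Q : ∀ i, Measure (S i)} [∀ i, IsProbabilityMeasure (Q i)] [MeasurableSpace Ω']
  {P : Measure Ω'} [IsProbabilityMeasure P] {Y : ∀ i, S i → ℝ} {Z : Ω' → ℝ} {l : Filter ι}

lemma MeasureTheory.TendstoInDistribution.tendsto_integral_comp
    (h : TendstoInDistribution Y l Z Q P) {g : ℝ → ℝ} (hg : Continuous g) {B : ℝ}
    (hB : ∀ y, |g y| ≤ B) :
    Tendsto (fun n => ∫ ω, g (Y n ω) ∂(Q n)) l (𝓝 (∫ ω, g (Z ω) ∂P)) := by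
  have := ProbabilityMeasure.tendsto_iff_forall_integral_tendsto.1 h.tendsto
    (BoundedContinuousFunction.ofNormedAddCommGroup g hg B hB)
  simp only [ProbabilityMeasure.coe_mk, BoundedContinuousFunction.coe_ofNormedAddCommGroup] at this
  rw [integral_map h.aemeasurable_limit hg.aestronglyMeasurable] at this
  refine this.congr fun n => ?_
  exact integral_map (h.forall_aemeasurable n) hg.aestronglyMeasurable

lemma abs_max_min_le (M y : ℝ) (hM : 0 ≤ M) : |max (-M) (min y M)| ≤ M := by
  rw [abs_le]; constructor
  · exact le_max_left _ _
  · exact max_le (by linarith) (min_le_right _ _)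

lemma sq_max_min_le (M y : ℝ) (hM : 0 ≤ M) : max (-M) (min y M) ^ 2 ≤ y ^ 2 := by
  rw [sq_le_sq]
  rcases le_total y M with h | h
  · rw [min_eq_left h]
    rcases le_total (-M) y with h' | h'
    · rw [max_eq_right h']
    · rw [max_eq_left h', abs_neg, abs_of_nonneg hM, abs_of_nonpos (by linarith)]
      linarith
  · rw [min_eq_right h, max_eq_right (by linarith), abs_of_nonneg hM,
      abs_of_nonneg (hM.trans h)]
    exact h

/-- The truncation error vanishes for `|y| ≤ M`; otherwise it is at most `|y| ≤ y ^ 2 / M`. Bounded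
second moments thus make it uniformly small. -/
lemma abs_sub_max_min_le (M y : ℝ) (hM : 0 < M) : |y - max (-M) (min y M)| ≤ y ^ 2 / M := by
  rw [le_div_iff₀ hM]
  rcases le_total y M with h | h
  · rw [min_eq_left h]
    rcases le_total (-M) y with h' | h'
    · rw [max_eq_right h']; simp; positivity
    · rw [max_eq_left h', abs_of_nonpos (by linarith)]
      nlinarith
  · rw [min_eq_right h, max_eq_right (by linarith), abs_of_nonneg (by linarith)]
    nlinarith

/-- A sequence that converges in distribution and has bounded second moments has a square
integrable limit. -/
lemma MeasureTheory.TendstoInDistribution.memLp_two_of_integral_sq_le [l.NeBot]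
    (h : TendstoInDistribution Y l Z Q P) {C : ℝ}
    (hint : ∀ᶠ n in l, Integrable (fun ω => Y n ω ^ 2) (Q n))
    (hC : ∀ᶠ n in l, ∫ ω, Y n ω ^ 2 ∂(Q n) ≤ C) :
    MemLp Z 2 P ∧ ∫ ω, Z ω ^ 2 ∂P ≤ C := by
  have hC0 : 0 ≤ C := by
    obtain ⟨n, hn⟩ := hC.exists
    exact (integral_nonneg fun ω => sq_nonneg _).trans hn
  have htrunc : ∀ M : ℕ, ∫ ω, max (-(M : ℝ)) (min (Z ω) M) ^ 2 ∂P ≤ C := by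
    intro M
    have hlim := h.tendsto_integral_comp (g := fun y => max (-(M : ℝ)) (min y M) ^ 2)
      (by fun_prop) (B := (M : ℝ) ^ 2) (fun y => by
        rw [abs_pow]
        exact pow_le_pow_left₀ (abs_nonneg _) (abs_max_min_le _ _ M.cast_nonneg) 2)
    refine le_of_tendsto hlim ?_
    filter_upwards [hint, hC] with n hn hCn
    exact (integral_mono_of_nonneg (ae_of_all _ fun ω => sq_nonneg _) hn
      (ae_of_all _ fun ω => sq_max_min_le _ _ M.cast_nonneg)).trans hCn
  have hZm := h.aemeasurable_limit
  -- Fatou's lemma along the truncation levels. The lower integral is used because the integrability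
  -- of `Z ^ 2` is still to be shown.
  have hl : ∫⁻ ω, ENNReal.ofReal (Z ω ^ 2) ∂P ≤ ENNReal.ofReal C := by
    have hpt : ∀ ω, ENNReal.ofReal (Z ω ^ 2)
        = liminf (fun M : ℕ => ENNReal.ofReal (max (-(M : ℝ)) (min (Z ω) M) ^ 2)) atTop := by
      intro ω
      refine (Tendsto.liminf_eq ?_).symm
      refine tendsto_const_nhds.congr' ?_
      filter_upwards [eventually_ge_atTop ⌈|Z ω|⌉₊] with M hM
      have hM' := abs_le.1 ((Nat.le_ceil _).trans (Nat.cast_le.2 hM : ((_ : ℕ) : ℝ) ≤ M))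
      rw [min_eq_left hM'.2, max_eq_right hM'.1]
    simp_rw [hpt]
    refine (lintegral_liminf_le' fun M => by fun_prop).trans ?_
    refine (liminf_le_liminf (v := fun _ : ℕ => ENNReal.ofReal C)
      (Eventually.of_forall fun M => ?_)).trans_eq (liminf_const _)
    rw [← ofReal_integral_eq_lintegral_ofReal _ (ae_of_all _ fun ω => sq_nonneg _)]
    · exact ENNReal.ofReal_le_ofReal (htrunc M)
    · refine Integrable.of_bound (by fun_prop) ((M : ℝ) ^ 2) (ae_of_all _ fun ω => ?_)
      rw [norm_pow]
      exact pow_le_pow_left₀ (abs_nonneg _) (abs_max_min_le _ _ M.cast_nonneg) 2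
  have hZi : Integrable (fun ω => Z ω ^ 2) P := by
    refine ⟨(by fun_prop : AEMeasurable _ P).aestronglyMeasurable, ?_⟩
    rw [hasFiniteIntegral_iff_ofReal (ae_of_all _ fun ω => sq_nonneg _)]
    exact hl.trans_lt ENNReal.ofReal_lt_top
  refine ⟨(memLp_two_iff_integrable_sq hZm.aestronglyMeasurable).2 hZi, ?_⟩
  rw [← ofReal_integral_eq_lintegral_ofReal hZi (ae_of_all _ fun ω => sq_nonneg _)] at hl
  exact (ENNReal.ofReal_le_ofReal_iff hC0).1 hl

lemma abs_integral_sub_integral_max_min_le {W : Ω' → ℝ} (hW : AEMeasurable W P)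
    (hW2 : Integrable (fun ω => W ω ^ 2) P) {C M : ℝ} (hC : ∫ ω, W ω ^ 2 ∂P ≤ C) (hM : 0 < M) :
    |∫ ω, W ω ∂P - ∫ ω, max (-M) (min (W ω) M) ∂P| ≤ C / M := by
  have hWi : Integrable W P :=
    ((memLp_two_iff_integrable_sq hW.aestronglyMeasurable).2 hW2).integrable one_le_two
  have hti : Integrable (fun ω => max (-M) (min (W ω) M)) P :=
    Integrable.of_bound (by fun_prop) M (ae_of_all _ fun ω => abs_max_min_le _ _ hM.le)
  rw [← integral_sub hWi hti]
  refine (abs_integral_le_integral_abs).trans ?_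
  calc _ ≤ ∫ ω, W ω ^ 2 / M ∂P := integral_mono_of_nonneg (ae_of_all _ fun ω => abs_nonneg _)
          (hW2.div_const M) (ae_of_all _ fun ω => abs_sub_max_min_le _ _ hM)
    _ = (∫ ω, W ω ^ 2 ∂P) / M := integral_div _ _
    _ ≤ C / M := by gcongr

/-- A sequence that converges in distribution and has bounded second moments converges in mean. -/
lemma MeasureTheory.TendstoInDistribution.tendsto_integral_of_integral_sq_le [l.NeBot]
    (h : TendstoInDistribution Y l Z Q P) {C : ℝ}
    (hint : ∀ᶠ n in l, Integrable (fun ω => Y n ω ^ 2) (Q n))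
    (hC : ∀ᶠ n in l, ∫ ω, Y n ω ^ 2 ∂(Q n) ≤ C) :
    Tendsto (fun n => ∫ ω, Y n ω ∂(Q n)) l (𝓝 (∫ ω, Z ω ∂P)) := by
  obtain ⟨hZ2, hZC⟩ := h.memLp_two_of_integral_sq_le hint hC
  have hC0 : 0 ≤ C := (integral_nonneg fun ω => sq_nonneg _).trans hZC
  rw [Metric.tendsto_nhds]
  intro ε hε
  -- Each of the two truncation errors is below `ε / 3`; the `+ 1` keeps `M` positive when `C = 0`.
  set M : ℝ := 3 * (C + 1) / ε with hM_def
  have hM : 0 < M := by positivity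
  have hCM : C / M < ε / 3 := by
    rw [div_lt_iff₀ hM, hM_def]; field_simp; linarith
  have hlim := h.tendsto_integral_comp (g := fun y => max (-M) (min y M)) (by fun_prop)
    (fun y => abs_max_min_le M y hM.le)
  have hlim' := (Metric.tendsto_nhds.1 hlim) (ε / 3) (by positivity)
  filter_upwards [hint, hC, hlim'] with n hn hCn hln
  have h1 := abs_integral_sub_integral_max_min_le (h.forall_aemeasurable n) hn hCn hM
  have h2 := abs_integral_sub_integral_max_min_le h.aemeasurable_limit hZ2.integrable_sq hZC hM
  rw [Real.dist_eq] at hln ⊢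
  rw [abs_lt] at hln ⊢
  rw [abs_le] at h1 h2
  constructor <;> linarith

end MomentConvergence

/-! ### Power sums, compared with integrals by telescoping. -/

section PowerSums

/-- Bernoulli's inequality at `1 / x`. This bound and the next three, at `± 1 / x` with exponent `α`
or `α + 1`, are the one-step comparisons that make the power sums telescope. -/
lemma add_one_rpow_le {α x : ℝ} (hα : α ∈ Set.Ioo (0 : ℝ) 1) (hx : 0 < x) :
    (x + 1) ^ α ≤ x ^ α + α * x ^ (α - 1) := by
  have h1 := rpow_one_add_le_one_add_mul_self (s := 1 / x)
    (by have : 0 < 1 / x := by positivity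
        linarith) hα.1.le hα.2.le
  have h2 : (x + 1) ^ α = x ^ α * (1 + 1 / x) ^ α := by
    rw [← Real.mul_rpow hx.le (by positivity)]
    congr 1; field_simp
  rw [h2, Real.rpow_sub_one hx.ne']
  calc _ ≤ x ^ α * (1 + α * (1 / x)) := by gcongr
    _ = _ := by ring

lemma sub_one_rpow_le {α x : ℝ} (hα : α ∈ Set.Ioo (0 : ℝ) 1) (hx : 1 ≤ x) :
    (x - 1) ^ α ≤ x ^ α - α * x ^ (α - 1) := by
  have hx0 : 0 < x := by linarith
  have hx1 : 1 / x ≤ 1 := by rw [div_le_one hx0]; exact hx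
  have h1 := rpow_one_add_le_one_add_mul_self (s := -(1 / x)) (by linarith) hα.1.le hα.2.le
  have h2 : (x - 1) ^ α = x ^ α * (1 + -(1 / x)) ^ α := by
    rw [← Real.mul_rpow hx0.le (by linarith)]
    congr 1; field_simp; ring
  rw [h2, Real.rpow_sub_one hx0.ne']
  calc _ ≤ x ^ α * (1 + α * -(1 / x)) := by gcongr
    _ = _ := by ring

lemma rpow_add_le_add_one_rpow {α x : ℝ} (hα : 0 < α) (hx : 0 ≤ x) :
    x ^ (α + 1) + (α + 1) * x ^ α ≤ (x + 1) ^ (α + 1) := by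
  rcases hx.eq_or_lt with rfl | hx0
  · simp [Real.zero_rpow hα.ne', Real.zero_rpow (by linarith : α + 1 ≠ 0)]
  have h1 := one_add_mul_self_le_rpow_one_add (s := 1 / x)
    (by have : 0 < 1 / x := by positivity
        linarith) (p := α + 1) (by linarith)
  have h2 : (x + 1) ^ (α + 1) = x ^ (α + 1) * (1 + 1 / x) ^ (α + 1) := by
    rw [← Real.mul_rpow hx0.le (by positivity)]
    congr 1; field_simp
  rw [h2]
  calc _ = x ^ (α + 1) * (1 + (α + 1) * (1 / x)) := by
        rw [Real.rpow_add_one hx0.ne']; field_simp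
    _ ≤ _ := by gcongr

lemma rpow_le_sub_one_rpow_add {α x : ℝ} (hα : 0 < α) (hx : 1 ≤ x) :
    x ^ (α + 1) - (α + 1) * x ^ α ≤ (x - 1) ^ (α + 1) := by
  have hx0 : 0 < x := by linarith
  have hx1 : 1 / x ≤ 1 := by rw [div_le_one hx0]; exact hx
  have h1 := one_add_mul_self_le_rpow_one_add (s := -(1 / x)) (by linarith) (p := α + 1)
    (by linarith)
  have h2 : (x - 1) ^ (α + 1) = x ^ (α + 1) * (1 + -(1 / x)) ^ (α + 1) := by
    rw [← Real.mul_rpow hx0.le (by linarith)]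
    congr 1; field_simp; ring
  rw [h2]
  calc _ = x ^ (α + 1) * (1 + (α + 1) * -(1 / x)) := by
        rw [Real.rpow_add_one hx0.ne']; field_simp; ring
    _ ≤ _ := by gcongr

lemma sum_rpow_sub_one_le {α : ℝ} (hα : α ∈ Set.Ioo (0 : ℝ) 1) (M : ℕ) :
    ∑ g ∈ Finset.Icc 1 M, (g : ℝ) ^ (α - 1) ≤ (M : ℝ) ^ α / α := by
  have hα0 := hα.1
  induction M with
  | zero => simp [Real.zero_rpow hα.1.ne']
  | succ M ih =>
    rw [Finset.sum_Icc_succ_top (by omega)]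
    have := sub_one_rpow_le hα (x := ((M + 1 : ℕ) : ℝ)) (by push_cast; linarith [M.cast_nonneg (α := ℝ)])
    rw [le_div_iff₀ hα0] at ih ⊢
    push_cast at this ⊢
    rw [add_sub_cancel_right] at this
    linarith

lemma le_sum_rpow_sub_one {α : ℝ} (hα : α ∈ Set.Ioo (0 : ℝ) 1) (M : ℕ) :
    ((M : ℝ) ^ α - 1) / α ≤ ∑ g ∈ Finset.Icc 1 M, (g : ℝ) ^ (α - 1) := by
  have hα0 := hα.1
  -- The shift to `M + 1` makes the induction close: the increment of the left side from `M + 1` to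
  -- `M + 2` is at most the new summand `(M + 1) ^ (α - 1)`.
  have key : ((M + 1 : ℝ) ^ α - 1) / α ≤ ∑ g ∈ Finset.Icc 1 M, (g : ℝ) ^ (α - 1) := by
    induction M with
    | zero => simp
    | succ M ih =>
      rw [Finset.sum_Icc_succ_top (by omega)]
      have := add_one_rpow_le hα (x := ((M + 1 : ℕ) : ℝ)) (by positivity)
      rw [div_le_iff₀ hα0] at ih ⊢
      push_cast at this ⊢
      linarith
  refine le_trans ?_ key
  gcongr
  linarith

lemma sum_range_rpow_le {α : ℝ} (hα : 0 < α) (L : ℕ) :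
    ∑ M ∈ Finset.range L, (M : ℝ) ^ α ≤ (L : ℝ) ^ (α + 1) / (α + 1) := by
  rw [le_div_iff₀ (by linarith)]
  induction L with
  | zero => simp [Real.zero_rpow (by linarith : α + 1 ≠ 0)]
  | succ L ih =>
    rw [Finset.sum_range_succ]
    have := rpow_add_le_add_one_rpow hα (x := (L : ℝ)) L.cast_nonneg
    push_cast
    linarith

lemma le_sum_range_rpow {α : ℝ} (hα : 0 < α) (L : ℕ) :
    (L : ℝ) ^ (α + 1) / (α + 1) ≤ ∑ M ∈ Finset.range (L + 1), (M : ℝ) ^ α := by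
  rw [div_le_iff₀ (by linarith)]
  induction L with
  | zero => simp [Real.zero_rpow (by linarith : α + 1 ≠ 0), Real.zero_rpow hα.ne']
  | succ L ih =>
    rw [Finset.sum_range_succ]
    have := rpow_le_sub_one_rpow_add hα (x := ((L + 1 : ℕ) : ℝ)) (by push_cast; linarith [L.cast_nonneg (α := ℝ)])
    push_cast at this ⊢
    rw [add_sub_cancel_right] at this
    linarith

/-- The double power sum `∑_{M < L} ∑_{g ≤ M} g ^ (α - 1)` grows like `L ^ (α + 1)`. -/
lemma tendsto_double_sum_rpow {α u : ℝ} (hα : α ∈ Set.Ioo (0 : ℝ) 1) (hu : 0 < u) {L : ℕ → ℕ}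
    (hL : Tendsto (fun n : ℕ => (L n : ℝ) / n) atTop (𝓝 u)) :
    Tendsto (fun n : ℕ => (∑ M ∈ Finset.range (L n), ∑ g ∈ Finset.Icc 1 M, (g : ℝ) ^ (α - 1))
      / (n : ℝ) ^ (α + 1)) atTop (𝓝 (u ^ (α + 1) / (α * (α + 1)))) := by
  have hα0 := hα.1
  have hp : 0 < α + 1 := by linarith
  have hlow : ∀ᶠ n : ℕ in atTop, 1 ≤ L n := by
    filter_upwards [hL.eventually_const_lt (half_lt_self hu)] with n hn
    by_contra h0
    have : L n = 0 := by omega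
    rw [this] at hn
    simp at hn
    linarith
  have hn0 : Tendsto (fun n : ℕ => (1 : ℝ) / n) atTop (𝓝 0) := tendsto_one_div_atTop_nhds_zero_nat
  have hnα : Tendsto (fun n : ℕ => (n : ℝ) ^ (-α)) atTop (𝓝 0) :=
    (tendsto_rpow_neg_atTop hα0).comp tendsto_natCast_atTop_atTop
  have hup : Tendsto (fun n : ℕ => ((L n : ℝ) / n) ^ (α + 1) / (α * (α + 1))) atTop
      (𝓝 (u ^ (α + 1) / (α * (α + 1)))) :=
    (hL.rpow_const (Or.inr hp.le)).div_const _
  -- The lower bound loses two negligible amounts: `1 / n`, as a sum over `range (l + 1)` is bounded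
  -- below by a power of `l = L n - 1`, and `L n / n * n ^ (-α)`, from the `- 1` in
  -- `le_sum_rpow_sub_one`.
  have hdn : Tendsto (fun n : ℕ => (((L n : ℝ) / n - 1 / n) ^ (α + 1) / (α + 1)
      - (L n : ℝ) / n * (n : ℝ) ^ (-α)) / α) atTop (𝓝 (u ^ (α + 1) / (α * (α + 1)))) := by
    have := ((((hL.sub hn0).rpow_const (Or.inr hp.le)).div_const (α + 1)).sub
      (hL.mul hnα)).div_const α
    convert this using 2
    rw [sub_zero, mul_zero, sub_zero]
    field_simp
  refine tendsto_of_tendsto_of_tendsto_of_le_of_le' hdn hup ?_ ?_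
  · filter_upwards [hlow, eventually_ge_atTop 1] with n hLn hn
    have hn' : (0 : ℝ) < n := by exact_mod_cast hn
    obtain ⟨l, hl⟩ : ∃ l, L n = l + 1 := ⟨L n - 1, by omega⟩
    have h1 : ∑ M ∈ Finset.range (L n), (((M : ℝ) ^ α - 1) / α)
        ≤ ∑ M ∈ Finset.range (L n), ∑ g ∈ Finset.Icc 1 M, (g : ℝ) ^ (α - 1) :=
      Finset.sum_le_sum fun M _ => le_sum_rpow_sub_one hα M
    have h2 := le_sum_range_rpow hα0 l
    rw [← Finset.sum_div, Finset.sum_sub_distrib] at h1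
    simp only [Finset.sum_const, Finset.card_range, nsmul_eq_mul, mul_one] at h1
    rw [le_div_iff₀ (by positivity)]
    refine le_trans (le_of_eq ?_) ((div_le_div_of_nonneg_right (sub_le_sub_right
      (hl ▸ h2) _) hα0.le).trans h1)
    have e1 : ((L n : ℝ) / n - 1 / n) = l / n := by rw [hl]; push_cast; ring
    rw [e1, Real.div_rpow l.cast_nonneg hn'.le, Real.rpow_neg hn'.le, Real.rpow_add_one hn'.ne',
      hl]
    field_simp
  · filter_upwards [eventually_ge_atTop 1] with n hn
    have hn' : (0 : ℝ) < n := by exact_mod_cast hn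
    rw [Real.div_rpow (by positivity) hn'.le, div_div, mul_comm _ (α * (α + 1)), ← div_div]
    gcongr
    refine (Finset.sum_le_sum fun M _ => sum_rpow_sub_one_le hα M).trans ?_
    rw [← Finset.sum_div, mul_comm α, ← div_div]
    gcongr
    exact sum_range_rpow_le hα0 _

lemma tendsto_floor_mul_div {t : ℝ} (ht : 0 ≤ t) :
    Tendsto (fun n : ℕ => (⌊(n : ℝ) * t⌋₊ : ℝ) / n) atTop (𝓝 t) := by
  have := (tendsto_nat_floor_mul_div_atTop ht).comp (tendsto_natCast_atTop_atTop (R := ℝ))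
  simpa [Function.comp_def, mul_comm t] using this

end PowerSums

/-! ### Moments of the scaled walk and their limits. -/

section ScaledWalk

variable {α b c T : ℝ} {S : ℕ → Type} [∀ n, MeasurableSpace (S n)] {Q : ∀ n, Measure (S n)}
  {ξ : ∀ n, ℕ → S n → ℝ}

lemma Ioc_floor_subset {n : ℕ} {s t : ℝ} (ht : t ≤ T) :
    Finset.Ioc ⌊(n : ℝ) * s⌋₊ ⌊(n : ℝ) * t⌋₊ ⊆ Finset.Icc 1 ⌊(n : ℝ) * T⌋₊ := by
  intro x hx
  rw [Finset.mem_Ioc] at hx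
  have : ⌊(n : ℝ) * t⌋₊ ≤ ⌊(n : ℝ) * T⌋₊ := Nat.floor_le_floor (by gcongr)
  rw [Finset.mem_Icc]; omega

lemma scaledWalk_sub {Ω : Type*} [MeasurableSpace Ω] (n : ℕ) (ζ : ℕ → Ω → ℝ) {s t : ℝ}
    (hst : s ≤ t) (ω : Ω) :
    scaledWalk α n ζ t ω - scaledWalk α n ζ s ω
      = (∑ i ∈ Finset.Ioc ⌊(n : ℝ) * s⌋₊ ⌊(n : ℝ) * t⌋₊, ζ i ω) / (n : ℝ) ^ α := by
  have hle : ⌊(n : ℝ) * s⌋₊ ≤ ⌊(n : ℝ) * t⌋₊ := Nat.floor_le_floor (by gcongr)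
  have e : Finset.Icc 1 ⌊(n : ℝ) * t⌋₊
      = Finset.Icc 1 ⌊(n : ℝ) * s⌋₊ ∪ Finset.Ioc ⌊(n : ℝ) * s⌋₊ ⌊(n : ℝ) * t⌋₊ := by
    ext x; simp only [Finset.mem_Icc, Finset.mem_union, Finset.mem_Ioc]; omega
  have hd : Disjoint (Finset.Icc 1 ⌊(n : ℝ) * s⌋₊)
      (Finset.Ioc ⌊(n : ℝ) * s⌋₊ ⌊(n : ℝ) * t⌋₊) := by
    rw [Finset.disjoint_left]; intro x; simp only [Finset.mem_Icc, Finset.mem_Ioc]; omega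
  rw [scaledWalk, scaledWalk, e, Finset.sum_union hd]
  ring

/-- The steps are nonnegative, so the terminal value dominates every earlier one, and moment bounds
at time `T` serve for all times. -/
lemma IsGBP.scaledWalk_mem_Icc {n : ℕ}
    (hG : IsGBP (Q n) ⌊(n : ℝ) * T⌋₊ b (fun x : ℕ => c * (x : ℝ) ^ (α - 1)) (ξ n)) {t : ℝ}
    (ht : t ≤ T) (ω : S n) :
    scaledWalk α n (ξ n) t ω ∈ Set.Icc 0 (scaledWalk α n (ξ n) T ω) := by
  have hsub : Finset.Icc 1 ⌊(n : ℝ) * t⌋₊ ⊆ Finset.Icc 1 ⌊(n : ℝ) * T⌋₊ :=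
    Finset.Icc_subset_Icc_right (Nat.floor_le_floor (by gcongr))
  refine ⟨div_nonneg (hG.sum_nonneg hsub ω) (by positivity),
    div_le_div_of_nonneg_right ?_ (by positivity)⟩
  exact Finset.sum_le_sum_of_subset_of_nonneg hsub fun i hi _ => hG.nonneg hi ω

lemma IsGBP.measurable_scaledWalk {n : ℕ}
    (hG : IsGBP (Q n) ⌊(n : ℝ) * T⌋₊ b (fun x : ℕ => c * (x : ℝ) ^ (α - 1)) (ξ n)) {t : ℝ}
    (ht : t ≤ T) : Measurable (scaledWalk α n (ξ n) t) :=
  (hG.measurable_sum (Finset.Icc_subset_Icc_right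
    (Nat.floor_le_floor (by gcongr)))).div_const _

/-- A polynomially bounded function of the scaled walk is integrable. -/
lemma IsGBP.integrable_of_abs_le [∀ n, IsProbabilityMeasure (Q n)] {n : ℕ}
    (hG : IsGBP (Q n) ⌊(n : ℝ) * T⌋₊ b (fun x : ℕ => c * (x : ℝ) ^ (α - 1)) (ξ n))
    {Y : S n → ℝ} (hY : AEMeasurable Y (Q n)) {K : ℕ}
    (hK : ∀ ω, |Y ω| ≤ scaledWalk α n (ξ n) T ω ^ K) : Integrable Y (Q n) := by
  refine Integrable.of_bound hY.aestronglyMeasurable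
    (((Finset.Icc 1 ⌊(n : ℝ) * T⌋₊).card / (n : ℝ) ^ α) ^ K) (ae_of_all _ fun ω => ?_)
  refine (hK ω).trans (pow_le_pow_left₀ (hG.scaledWalk_mem_Icc le_rfl ω).1 ?_ K)
  exact div_le_div_of_nonneg_right (hG.sum_le le_rfl ω) (by positivity)

/-- The moments of the scaled walk at the final time are bounded. -/
lemma exists_integral_scaledWalk_pow_le [∀ n, IsProbabilityMeasure (Q n)]
    (hα : α ∈ Set.Ioo (0 : ℝ) 1) (hb : 0 < b) (hc : 0 < c) (hT : 0 < T)
    (hG : ∀ n, IsGBP (Q n) ⌊(n : ℝ) * T⌋₊ b (fun x : ℕ => c * (x : ℝ) ^ (α - 1)) (ξ n)) (k : ℕ) :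
    ∃ C, ∀ᶠ n in atTop, ∫ ω, scaledWalk α n (ξ n) T ω ^ k ∂(Q n) ≤ C := by
  rcases k with _ | k
  · exact ⟨1, by simp⟩
  refine ⟨2 ^ (k + 1) * (k + 1).factorial * (b * c * (c / α) ^ k * (T ^ α) ^ (k + 1))
        + (2 * (k + 1)) ^ (k + 1), ?_⟩
  filter_upwards [eventually_ge_atTop 1, (tendsto_nat_floor_atTop (α := ℝ)).comp
    ((tendsto_natCast_atTop_atTop (R := ℝ)).atTop_mul_const hT) |>.eventually_ge_atTop 1]
    with n hn hN
  have hn' : (1 : ℝ) ≤ n := by exact_mod_cast hn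
  have hnα : 1 ≤ (n : ℝ) ^ α := Real.one_le_rpow hn' hα.1.le
  simp only [Function.comp_apply] at hN
  set N := ⌊(n : ℝ) * T⌋₊ with hN_def
  have hNpos : (0 : ℝ) < N := by exact_mod_cast hN
  have h1 := (hG n).integral_sum_pow_le (fun m => by positivity) k
  have e : ∫ ω, scaledWalk α n (ξ n) T ω ^ (k + 1) ∂(Q n)
      = (∫ ω, (∑ i ∈ Finset.Icc 1 N, ξ n i ω) ^ (k + 1) ∂(Q n)) / ((n : ℝ) ^ α) ^ (k + 1) := by
    rw [← integral_div]
    simp_rw [scaledWalk, div_pow]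
    rfl
  rw [e, div_le_iff₀ (by positivity)]
  refine h1.trans ?_
  rw [add_mul]
  have hNT : (N : ℝ) ^ α ≤ T ^ α * (n : ℝ) ^ α := by
    rw [← Real.mul_rpow hT.le (by positivity), mul_comm T]
    exact Real.rpow_le_rpow hNpos.le (Nat.floor_le (by positivity)) hα.1.le
  have hα0 := hα.1
  have hsum : ∑ g ∈ Finset.Icc 1 N, c * (g : ℝ) ^ (α - 1) ≤ c / α * (N : ℝ) ^ α := by
    rw [← Finset.mul_sum]
    refine (mul_le_mul_of_nonneg_left (sum_rpow_sub_one_le hα N) hc.le).trans_eq ?_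
    ring
  refine add_le_add ?_ ?_
  -- The expected count is `b c N ^ α`, and each of the `k` sums of `f` is at most `c / α * N ^ α`;
  -- together they match the normalisation `n ^ (α (k + 1))`.
  · rw [mul_assoc (2 ^ (k + 1) * ((k + 1).factorial : ℝ))]
    refine mul_le_mul_of_nonneg_left ?_ (by positivity)
    have e1 : (N : ℝ) * (b * (c * (N : ℝ) ^ (α - 1))) = b * c * (N : ℝ) ^ α := by
      rw [Real.rpow_sub_one hNpos.ne']; field_simp
    rw [e1]
    calc b * c * (N : ℝ) ^ α * (∑ g ∈ Finset.Icc 1 N, c * (g : ℝ) ^ (α - 1)) ^ k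
        ≤ b * c * (N : ℝ) ^ α * (c / α * (N : ℝ) ^ α) ^ k := by
          gcongr
      _ = b * c * (c / α) ^ k * ((N : ℝ) ^ α) ^ (k + 1) := by ring
      _ ≤ b * c * (c / α) ^ k * (T ^ α * (n : ℝ) ^ α) ^ (k + 1) := by gcongr
      _ = _ := by ring
  · exact le_mul_of_one_le_right (by positivity) (one_le_pow₀ hnα)

variable {Ω : Type*} [MeasurableSpace Ω] {P : Measure Ω} [IsProbabilityMeasure P]
  {X : ℝ → Ω → ℝ}

/-- Convergence of the expectations of polynomially bounded continuous functionals of the scaled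
walk. -/
lemma tendsto_integral_functional [∀ n, IsProbabilityMeasure (Q n)]
    (hα : α ∈ Set.Ioo (0 : ℝ) 1) (hb : 0 < b) (hc : 0 < c) (hT : 0 < T)
    (hG : ∀ n, IsGBP (Q n) ⌊(n : ℝ) * T⌋₊ b (fun x : ℕ => c * (x : ℝ) ^ (α - 1)) (ξ n))
    (hX : ∀ (m : ℕ) (t : Fin m → ℝ), (∀ j, t j ∈ Set.Icc 0 T) →
      TendstoInDistribution (fun n ω j => scaledWalk α n (ξ n) (t j) ω) atTop
        (fun ω j => c * Real.Gamma α * X (t j) ω) Q P)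
    {m : ℕ} {t : Fin m → ℝ} (ht : ∀ j, t j ∈ Set.Icc 0 T) {g : (Fin m → ℝ) → ℝ}
    (hg : Continuous g) {K : ℕ}
    (hK : ∀ n ω, |g fun j => scaledWalk α n (ξ n) (t j) ω| ≤ scaledWalk α n (ξ n) T ω ^ K) :
    MemLp (fun ω => g fun j => c * Real.Gamma α * X (t j) ω) 2 P ∧
    Tendsto (fun n => ∫ ω, g (fun j => scaledWalk α n (ξ n) (t j) ω) ∂(Q n)) atTop
      (𝓝 (∫ ω, g (fun j => c * Real.Gamma α * X (t j) ω) ∂P)) := by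
  have hd := (hX m t ht).continuous_comp hg
  -- Convergence of means needs bounded second moments of the functional, hence order `2 K` for the
  -- walk.
  obtain ⟨C, hC⟩ := exists_integral_scaledWalk_pow_le hα hb hc hT hG (K * 2)
  have hsq : ∀ n ω, |(g fun j => scaledWalk α n (ξ n) (t j) ω) ^ 2|
      ≤ scaledWalk α n (ξ n) T ω ^ (K * 2) := by
    intro n ω
    rw [abs_pow, pow_mul]
    exact pow_le_pow_left₀ (abs_nonneg _) (hK n ω) 2
  have hint : ∀ n, Integrable (fun ω => (g fun j => scaledWalk α n (ξ n) (t j) ω) ^ 2) (Q n) :=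
    fun n => (hG n).integrable_of_abs_le ((hd.forall_aemeasurable n).pow_const 2) (hsq n)
  have hbd : ∀ᶠ n in atTop,
      ∫ ω, (g fun j => scaledWalk α n (ξ n) (t j) ω) ^ 2 ∂(Q n) ≤ C := by
    filter_upwards [hC] with n hn
    refine (integral_mono (hint n) ?_ fun ω => (le_abs_self _).trans (hsq n ω)).trans hn
    refine (hG n).integrable_of_abs_le
      (((hG n).measurable_scaledWalk le_rfl).pow_const _).aemeasurable (K := K * 2) fun ω => ?_
    rw [abs_of_nonneg (pow_nonneg ((hG n).scaledWalk_mem_Icc le_rfl ω).1 _)]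
  exact ⟨(hd.memLp_two_of_integral_sq_le (.of_forall hint) hbd).1,
    hd.tendsto_integral_of_integral_sq_le (.of_forall hint) hbd⟩

lemma memLp_of_walk [∀ n, IsProbabilityMeasure (Q n)]
    (hα : α ∈ Set.Ioo (0 : ℝ) 1) (hb : 0 < b) (hc : 0 < c) (hT : 0 < T)
    (hG : ∀ n, IsGBP (Q n) ⌊(n : ℝ) * T⌋₊ b (fun x : ℕ => c * (x : ℝ) ^ (α - 1)) (ξ n))
    (hX : ∀ (m : ℕ) (t : Fin m → ℝ), (∀ j, t j ∈ Set.Icc 0 T) →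
      TendstoInDistribution (fun n ω j => scaledWalk α n (ξ n) (t j) ω) atTop
        (fun ω j => c * Real.Gamma α * X (t j) ω) Q P)
    {t : ℝ} (ht : t ∈ Set.Icc 0 T) (p : NNReal) : MemLp (X t) p P := by
  have hcΓ : c * Real.Gamma α ≠ 0 := (mul_pos hc (Real.Gamma_pos_of_pos hα.1)).ne'
  obtain ⟨k, hk⟩ := exists_nat_ge p
  have h0 : 0 < k + 1 := k.succ_pos
  have hmem := (tendsto_integral_functional hα hb hc hT hG hX (t := fun _ : Fin 1 => t)
    (fun _ => ht) (g := fun v => v 0 ^ (k + 1)) (by fun_prop) (K := k + 1) fun n ω => by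
      have := (hG n).scaledWalk_mem_Icc ht.2 ω
      rw [abs_of_nonneg (pow_nonneg this.1 _)]
      exact pow_le_pow_left₀ this.1 this.2 _).1
  have hXm : AEMeasurable (fun ω => c * Real.Gamma α * X t ω) P :=
    (hX 1 (fun _ => t) fun _ => ht).aemeasurable_limit.eval 0
  have hm : MemLp (fun ω => c * Real.Gamma α * X t ω) ((k + 1 : ℕ) : ENNReal) P := by
    have h1 := hmem.integrable one_le_two
    rw [← integrable_norm_rpow_iff hXm.aestronglyMeasurable (by simp) (by simp)]
    simpa only [norm_pow, ENNReal.toReal_natCast, Real.rpow_natCast] using h1.norm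
  have hm' := hm.const_mul (c * Real.Gamma α)⁻¹
  simp only [inv_mul_cancel_left₀ hcΓ] at hm'
  refine hm'.mono_exponent ?_
  have : p ≤ ((k + 1 : ℕ) : NNReal) := hk.trans (by push_cast; simp)
  exact_mod_cast this

/-- Convergence of the mixed moments of increments. -/
lemma tendsto_integral_prod_increments [∀ n, IsProbabilityMeasure (Q n)]
    (hα : α ∈ Set.Ioo (0 : ℝ) 1) (hb : 0 < b) (hc : 0 < c) (hT : 0 < T)
    (hG : ∀ n, IsGBP (Q n) ⌊(n : ℝ) * T⌋₊ b (fun x : ℕ => c * (x : ℝ) ^ (α - 1)) (ξ n))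
    (hX : ∀ (m : ℕ) (t : Fin m → ℝ), (∀ j, t j ∈ Set.Icc 0 T) →
      TendstoInDistribution (fun n ω j => scaledWalk α n (ξ n) (t j) ω) atTop
        (fun ω j => c * Real.Gamma α * X (t j) ω) Q P)
    {m : ℕ} (s t : Fin m → ℝ) (hs : ∀ j, 0 ≤ s j) (hst : ∀ j, s j ≤ t j) (ht : ∀ j, t j ≤ T)
    (k : Fin m → ℕ) :
    Tendsto (fun n => (∫ ω, ∏ j, (∑ i ∈ Finset.Ioc ⌊(n : ℝ) * s j⌋₊ ⌊(n : ℝ) * t j⌋₊, ξ n i ω) ^ k j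
        ∂(Q n)) / ((n : ℝ) ^ α) ^ (∑ j, k j)) atTop
      (𝓝 ((c * Real.Gamma α) ^ (∑ j, k j) * ∫ ω, ∏ j, (X (t j) ω - X (s j) ω) ^ k j ∂P)) := by
  -- All left and right endpoints form one tuple of times, to which joint convergence applies.
  have hst' : ∀ j, Fin.append s t j ∈ Set.Icc 0 T := by
    intro j
    refine Fin.addCases (fun j => ?_) (fun j => ?_) j
    · rw [Fin.append_left]; exact ⟨hs j, (hst j).trans (ht j)⟩
    · rw [Fin.append_right]; exact ⟨(hs j).trans (hst j), ht j⟩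
  have h := (tendsto_integral_functional hα hb hc hT hG hX hst'
    (g := fun v => ∏ j : Fin m, (v (Fin.natAdd m j) - v (Fin.castAdd m j)) ^ k j) (by fun_prop)
    (K := ∑ j, k j) fun n ω => by
      simp only [Fin.append_left, Fin.append_right]
      rw [← Finset.prod_pow_eq_pow_sum, Finset.abs_prod]
      refine Finset.prod_le_prod (fun j _ => abs_nonneg _) fun j _ => ?_
      rw [abs_pow]
      refine pow_le_pow_left₀ (abs_nonneg _) ?_ _
      have h1 := (hG n).scaledWalk_mem_Icc (ht j) ω
      have h2 := (hG n).scaledWalk_mem_Icc ((hst j).trans (ht j)) ω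
      exact abs_sub_le_of_nonneg_of_le h1.1 h1.2 h2.1 h2.2).2
  simp only [Fin.append_left, Fin.append_right] at h
  rw [← integral_const_mul]
  convert h using 2 with n
  · rw [← integral_div]
    congr 1
    ext ω
    rw [← Finset.prod_pow_eq_pow_sum, ← Finset.prod_div_distrib]
    refine Finset.prod_congr rfl fun j _ => ?_
    rw [scaledWalk_sub n (ξ n) (hst j), div_pow]
  · congr 1
    ext ω
    rw [← Finset.prod_pow_eq_pow_sum, ← Finset.prod_mul_distrib]
    refine Finset.prod_congr rfl fun j _ => ?_
    rw [← mul_pow]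
    ring

end ScaledWalk

/-! ### Scaling limits of success probabilities and gaps. -/

section Limits

lemma tendsto_success_probability {α b c T : ℝ} (hT : 0 < T) :
    Tendsto (fun n : ℕ => b * (c * (⌊(n : ℝ) * T⌋₊ : ℝ) ^ (α - 1)) / (n : ℝ) ^ (α - 1)) atTop
      (𝓝 (b * c * T ^ (α - 1))) := by
  have h := ((tendsto_floor_mul_div hT.le).rpow_const (p := α - 1) (Or.inl hT.ne')).const_mul (b * c)
  refine h.congr fun n => ?_
  rw [Real.div_rpow (by positivity) (by positivity)]
  ring

/-- Numerator and denominator both scale like `n ^ (α - 1)`, and `c` cancels. This is the source of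
the factors in the limit of mixed moments. -/
lemma tendsto_gap_ratio {α b c T u : ℝ} (hb : b ≠ 0) (hc : c ≠ 0) (hT : 0 < T) (hu : 0 < u)
    {L : ℕ → ℕ} (hL : Tendsto (fun n : ℕ => (L n : ℝ) / n) atTop (𝓝 u)) :
    Tendsto (fun n : ℕ => c * (L n : ℝ) ^ (α - 1) / (b * (c * (⌊(n : ℝ) * T⌋₊ : ℝ) ^ (α - 1)))) atTop
      (𝓝 (u ^ (α - 1) / (b * T ^ (α - 1)))) := by
  have hne : b * c * T ^ (α - 1) ≠ 0 :=
    mul_ne_zero (mul_ne_zero hb hc) (Real.rpow_pos_of_pos hT _).ne'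
  have h := ((hL.rpow_const (p := α - 1) (Or.inl hu.ne')).const_mul c).div
    (tendsto_success_probability (α := α) (b := b) (c := c) hT) hne
  have e : c * u ^ (α - 1) / (b * c * T ^ (α - 1)) = u ^ (α - 1) / (b * T ^ (α - 1)) := by
    field_simp
  rw [e] at h
  refine h.congr' ?_
  filter_upwards [eventually_ge_atTop 1] with n hn
  have hn' : (0 : ℝ) < n := by exact_mod_cast hn
  have : (0 : ℝ) < (n : ℝ) ^ (α - 1) := by positivity
  simp only [Pi.div_apply]
  rw [Real.div_rpow (by positivity) (by positivity)]
  field_simp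

lemma tendsto_floor_sub_floor_div {s t : ℝ} (hs : 0 ≤ s) (hst : s ≤ t) :
    Tendsto (fun n : ℕ => ((⌊(n : ℝ) * t⌋₊ - ⌊(n : ℝ) * s⌋₊ : ℕ) : ℝ) / n) atTop (𝓝 (t - s)) := by
  refine ((tendsto_floor_mul_div (hs.trans hst)).sub (tendsto_floor_mul_div hs)).congr fun n => ?_
  rw [Nat.cast_sub (Nat.floor_le_floor (by gcongr))]
  ring

lemma eventually_pos_of_tendsto_div {u : ℝ} (hu : 0 < u) {L : ℕ → ℕ}
    (hL : Tendsto (fun n : ℕ => (L n : ℝ) / n) atTop (𝓝 u)) : ∀ᶠ n in atTop, 0 < L n := by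
  filter_upwards [hL.eventually_const_lt hu] with n hn
  by_contra h0
  rw [Nat.eq_zero_of_not_pos h0] at hn
  simp at hn

end Limits

/-! ### Moments of the increments of the limit process. -/

section Moments

variable {Ω : Type*} [MeasurableSpace Ω] {P : Measure Ω} [IsProbabilityMeasure P]
  {α b T : ℝ} {X : ℝ → Ω → ℝ}

namespace IsMittagLefflerProcess

lemma memLp (hX : IsMittagLefflerProcess P α b T X) (hα : α ∈ Set.Ioo (0 : ℝ) 1) (hb : 0 < b)
    (hT : 0 < T) {t : ℝ} (ht : t ∈ Set.Icc 0 T) (p : NNReal) : MemLp (X t) p P := by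
  obtain ⟨c, hc, -, S, _, Q, _, ξ, hG, hX⟩ := hX
  exact memLp_of_walk hα hb hc hT hG hX ht p

/-- About `n (t - s)` indices each succeed with probability `b f(⌊n T⌋)`, of order `n ^ (α - 1)`;
the product matches the scale `n ^ α`. -/
lemma integral_increment (hX : IsMittagLefflerProcess P α b T X) (hα : α ∈ Set.Ioo (0 : ℝ) 1)
    (hb : 0 < b) (hT : 0 < T) {s t : ℝ} (hs : 0 ≤ s) (hst : s ≤ t) (ht : t ≤ T) :
    ∫ ω, (X t ω - X s ω) ∂P = b * T ^ (α - 1) / Real.Gamma α * (t - s) := by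
  obtain ⟨c, hc, -, S, _, Q, _, ξ, hG, hX⟩ := hX
  have hΓ := Real.Gamma_pos_of_pos hα.1
  have h1 := tendsto_integral_prod_increments hα hb hc hT hG hX (fun _ : Fin 1 => s) (fun _ => t)
    (fun _ => hs) (fun _ => hst) (fun _ => ht) (fun _ => 1)
  simp only [Finset.univ_unique, Finset.prod_singleton, Finset.sum_singleton, pow_one] at h1
  have h2 := (tendsto_floor_sub_floor_div hs hst).mul
    (tendsto_success_probability (α := α) (b := b) (c := c) hT)
  have h3 := tendsto_nhds_unique h1 (h2.congr' ?_)
  · rw [div_mul_eq_mul_div, eq_div_iff hΓ.ne']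
    have : c * (b * T ^ (α - 1) * (t - s)) = c * ((∫ ω, (X t ω - X s ω) ∂P) * Real.Gamma α) := by
      linarith
    exact (mul_left_cancel₀ hc.ne' this).symm
  · filter_upwards [eventually_ge_atTop 1] with n hn
    have hn' : (0 : ℝ) < n := by exact_mod_cast hn
    rw [(hG n).integral_sum_eq (Ioc_floor_subset ht), Nat.card_Ioc, Real.rpow_sub_one hn'.ne']
    field_simp

lemma integral_increment_sq (hX : IsMittagLefflerProcess P α b T X) (hα : α ∈ Set.Ioo (0 : ℝ) 1)
    (hb : 0 < b) (hT : 0 < T) {s t : ℝ} (hs : 0 ≤ s) (hst : s < t) (ht : t ≤ T) :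
    ∫ ω, (X t ω - X s ω) ^ 2 ∂P
      = 2 * (b * T ^ (α - 1) / (Real.Gamma α * Real.Gamma (α + 2))) * (t - s) ^ (α + 1) := by
  obtain ⟨c, hc, -, S, _, Q, _, ξ, hG, hX⟩ := hX
  have hΓ := Real.Gamma_pos_of_pos hα.1
  have hα0 := hα.1
  have hΓ2 : Real.Gamma (α + 2) = (α + 1) * α * Real.Gamma α := by
    rw [show α + 2 = (α + 1) + 1 by ring, Real.Gamma_add_one (by linarith),
      Real.Gamma_add_one hα0.ne']
    ring
  have h1 := tendsto_integral_prod_increments hα hb hc hT hG hX (fun _ : Fin 1 => s) (fun _ => t)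
    (fun _ => hs) (fun _ => hst.le) (fun _ => ht) (fun _ => 2)
  simp only [Finset.univ_unique, Finset.prod_singleton, Finset.sum_singleton] at h1
  have hL := tendsto_floor_sub_floor_div hs hst.le
  have hD := tendsto_double_sum_rpow hα (sub_pos.2 hst) hL
  have hnα : Tendsto (fun n : ℕ => (n : ℝ) ^ (-α)) atTop (𝓝 0) :=
    (tendsto_rpow_neg_atTop hα0).comp tendsto_natCast_atTop_atTop
  -- The term `hL.mul hnα` is the diagonal contribution and vanishes; the double sum over gaps
  -- carries the limit.
  have h2 := (tendsto_success_probability (α := α) (b := b) (c := c) hT).mul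
    ((hL.mul hnα).add ((hD.const_mul c).const_mul 2))
  have h3 := tendsto_nhds_unique h1 (h2.congr' ?_)
  · rw [hΓ2]
    rw [mul_zero, zero_add] at h3
    have hne : (c * Real.Gamma α) ^ 2 ≠ 0 := by positivity
    refine mul_left_cancel₀ hne (h3.trans ?_)
    field_simp
  · filter_upwards [eventually_ge_atTop 1] with n hn
    have hn' : (0 : ℝ) < n := by exact_mod_cast hn
    have hle : ⌊(n : ℝ) * s⌋₊ ≤ ⌊(n : ℝ) * t⌋₊ := Nat.floor_le_floor (by gcongr)
    have hle' : ⌊(n : ℝ) * t⌋₊ ≤ ⌊(n : ℝ) * T⌋₊ := Nat.floor_le_floor (by gcongr)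
    have e := (hG n).integral_sum_sq ⌊(n : ℝ) * s⌋₊ (⌊(n : ℝ) * t⌋₊ - ⌊(n : ℝ) * s⌋₊) (by omega)
    rw [Nat.add_sub_cancel' hle] at e
    rw [e, Real.rpow_sub_one hn'.ne', Real.rpow_add_one hn'.ne', Real.rpow_neg hn'.le]
    simp_rw [← Finset.mul_sum]
    field_simp

/-- Mixed moments of increments over separated intervals, compared with the products of the moments
of the single increments. -/
lemma integral_prod_increments_mem_Icc (hX : IsMittagLefflerProcess P α b T X)
    (hα : α ∈ Set.Ioo (0 : ℝ) 1) (hb : 0 < b) (hT : 0 < T) {m : ℕ} {s t : Fin (m + 1) → ℝ}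
    (hs : ∀ j, 0 ≤ s j) (hst : ∀ j, s j < t j) (hts : ∀ j j', j < j' → t j ≤ s j')
    (hts' : ∀ j : Fin m, t j.castSucc < s j.succ)
    (ht : ∀ j, t j ≤ T) {k : Fin (m + 1) → ℕ} (hk : ∀ j, 1 ≤ k j) :
    ∫ ω, ∏ j, (X (t j) ω - X (s j) ω) ^ k j ∂P ∈ Set.Icc
      ((∏ j : Fin m, (t j.succ - s j.castSucc) ^ (α - 1) / (b * T ^ (α - 1))) *
        ∏ j, ∫ ω, (X (t j) ω - X (s j) ω) ^ k j ∂P)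
      ((∏ j : Fin m, (s j.succ - t j.castSucc) ^ (α - 1) / (b * T ^ (α - 1))) *
        ∏ j, ∫ ω, (X (t j) ω - X (s j) ω) ^ k j ∂P) := by
  obtain ⟨c, hc, -, S, _, Q, _, ξ, hG, hX⟩ := hX
  have hΓ := Real.Gamma_pos_of_pos hα.1
  have hnum := tendsto_integral_prod_increments hα hb hc hT hG hX s t hs (fun j => (hst j).le) ht k
  have hden : Tendsto (fun n => ∏ j, (∫ ω, (∑ i ∈ Finset.Ioc ⌊(n : ℝ) * s j⌋₊ ⌊(n : ℝ) * t j⌋₊,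
      ξ n i ω) ^ k j ∂(Q n)) / ((n : ℝ) ^ α) ^ k j) atTop
      (𝓝 (∏ j, ((c * Real.Gamma α) ^ k j * ∫ ω, (X (t j) ω - X (s j) ω) ^ k j ∂P))) := by
    refine tendsto_finsetProd _ fun j _ => ?_
    have h1 := tendsto_integral_prod_increments hα hb hc hT hG hX (fun _ : Fin 1 => s j)
      (fun _ => t j) (fun _ => hs j) (fun _ => (hst j).le) (fun _ => ht j) (fun _ => k j)
    simpa only [Finset.univ_unique, Finset.prod_singleton, Finset.sum_singleton] using h1
  have hlt : ∀ j : Fin m, s j.castSucc < t j.succ := fun j =>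
    (hst _).trans ((hts' j).trans (hst _))
  -- As `f` decreases, the longest gap between neighbouring blocks, from the left end of one to the
  -- right end of the next, gives the lower bound, and the shortest gives the upper one.
  have hLlo := fun j : Fin m => tendsto_floor_sub_floor_div (hs j.castSucc) (hlt j).le
  have hLhi := fun j : Fin m => tendsto_floor_sub_floor_div ((hs j.castSucc).trans (hst _).le)
    (hts' j).le
  have hlo := (tendsto_finsetProd Finset.univ fun (j : Fin m) _ =>
    tendsto_gap_ratio (α := α) hb.ne' hc.ne' hT (sub_pos.2 (hlt j)) (hLlo j)).mul hden
  have hhi := (tendsto_finsetProd Finset.univ fun (j : Fin m) _ =>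
    tendsto_gap_ratio (α := α) hb.ne' hc.ne' hT (sub_pos.2 (hts' j)) (hLhi j)).mul hden
  have hev : ∀ᶠ n : ℕ in atTop, (∏ j : Fin m, c *
        ((⌊(n : ℝ) * t j.succ⌋₊ - ⌊(n : ℝ) * s j.castSucc⌋₊ : ℕ) : ℝ) ^ (α - 1) /
          (b * (c * (⌊(n : ℝ) * T⌋₊ : ℝ) ^ (α - 1)))) *
        (∏ j, (∫ ω, (∑ i ∈ Finset.Ioc ⌊(n : ℝ) * s j⌋₊ ⌊(n : ℝ) * t j⌋₊,
          ξ n i ω) ^ k j ∂(Q n)) / ((n : ℝ) ^ α) ^ k j) ≤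
      (∫ ω, ∏ j, (∑ i ∈ Finset.Ioc ⌊(n : ℝ) * s j⌋₊ ⌊(n : ℝ) * t j⌋₊, ξ n i ω) ^ k j
        ∂(Q n)) / ((n : ℝ) ^ α) ^ (∑ j, k j) ∧
      (∫ ω, ∏ j, (∑ i ∈ Finset.Ioc ⌊(n : ℝ) * s j⌋₊ ⌊(n : ℝ) * t j⌋₊, ξ n i ω) ^ k j
        ∂(Q n)) / ((n : ℝ) ^ α) ^ (∑ j, k j) ≤ (∏ j : Fin m, c *
        ((⌊(n : ℝ) * s j.succ⌋₊ - ⌊(n : ℝ) * t j.castSucc⌋₊ : ℕ) : ℝ) ^ (α - 1) /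
          (b * (c * (⌊(n : ℝ) * T⌋₊ : ℝ) ^ (α - 1)))) *
        (∏ j, (∫ ω, (∑ i ∈ Finset.Ioc ⌊(n : ℝ) * s j⌋₊ ⌊(n : ℝ) * t j⌋₊,
          ξ n i ω) ^ k j ∂(Q n)) / ((n : ℝ) ^ α) ^ k j) := by
    have hpos := eventually_all.2 fun j : Fin m =>
      eventually_pos_of_tendsto_div (sub_pos.2 (hts' j)) (hLhi j)
    filter_upwards [hpos, eventually_pos_of_tendsto_div hT (tendsto_floor_mul_div hT.le),
      eventually_ge_atTop 1] with n hpos hN hn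
    have hN' : (0 : ℝ) < ⌊(n : ℝ) * T⌋₊ := by exact_mod_cast hN
    have hn' : (0 : ℝ) < n := by exact_mod_cast hn
    have key := (hG n).integral_prod_sum_pow_mem_Icc (by positivity) m
      (fun j => Finset.Ioc ⌊(n : ℝ) * s j⌋₊ ⌊(n : ℝ) * t j⌋₊)
      (fun j => Ioc_floor_subset (ht j)) (fun j j' hjj' x hx y hy => by
        have h1 := (Finset.mem_Ioc.1 hx).2
        have h2 := (Finset.mem_Ioc.1 hy).1
        have h3 : ⌊(n : ℝ) * t j⌋₊ ≤ ⌊(n : ℝ) * s j'⌋₊ :=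
          Nat.floor_le_floor (by gcongr; exact hts _ _ hjj')
        omega) k hk
      (fun j => c * ((⌊(n : ℝ) * t j.succ⌋₊ - ⌊(n : ℝ) * s j.castSucc⌋₊ : ℕ) : ℝ) ^ (α - 1))
      (fun j => c * ((⌊(n : ℝ) * s j.succ⌋₊ - ⌊(n : ℝ) * t j.castSucc⌋₊ : ℕ) : ℝ) ^ (α - 1))
      (fun j => by positivity) (fun j x hx y hy => by
        have h1 := Finset.mem_Ioc.1 hx
        have h2 := Finset.mem_Ioc.1 hy
        have h3 := hpos j
        have hα1 : α - 1 ≤ 0 := by linarith [hα.2]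
        have h4 : 0 < y - x := by omega
        constructor
        · refine mul_le_mul_of_nonneg_left (Real.rpow_le_rpow_of_nonpos
            (by exact_mod_cast h4) ?_ hα1) hc.le
          exact_mod_cast (by omega : y - x ≤ _)
        · refine mul_le_mul_of_nonneg_left (Real.rpow_le_rpow_of_nonpos
            (by exact_mod_cast h3) ?_ hα1) hc.le
          exact_mod_cast (by omega : _ ≤ y - x))
    rw [Finset.prod_div_distrib (s := Finset.univ) (g := fun j => ((n : ℝ) ^ α) ^ k j),
      Finset.prod_pow_eq_pow_sum, ← mul_div_assoc, ← mul_div_assoc]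
    exact ⟨div_le_div_of_nonneg_right key.1 (by positivity),
      div_le_div_of_nonneg_right key.2 (by positivity)⟩
  have hKpos : 0 < (c * Real.Gamma α) ^ (∑ j, k j) := by positivity
  rw [Finset.prod_mul_distrib, Finset.prod_pow_eq_pow_sum, mul_left_comm] at hlo hhi
  exact ⟨le_of_mul_le_mul_left
      (le_of_tendsto_of_tendsto hlo hnum (hev.mono fun n h => h.1)) hKpos,
    le_of_mul_le_mul_left
      (le_of_tendsto_of_tendsto hnum hhi (hev.mono fun n h => h.2)) hKpos⟩

/-- Jensen's inequality for the nonnegative counts, passed to the limit, bounds the moment below by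
a power of the positive mean. Working with the counts avoids having to show that `X` is almost
surely nondecreasing. -/
lemma integral_increment_pow_pos (hX : IsMittagLefflerProcess P α b T X)
    (hα : α ∈ Set.Ioo (0 : ℝ) 1) (hb : 0 < b) (hT : 0 < T) {s t : ℝ} (hs : 0 ≤ s) (hst : s < t)
    (ht : t ≤ T) (k : ℕ) : 0 < ∫ ω, (X t ω - X s ω) ^ k ∂P := by
  have hΓ := Real.Gamma_pos_of_pos hα.1
  have hmean : 0 < ∫ ω, (X t ω - X s ω) ∂P := by
    rw [hX.integral_increment hα hb hT hs hst.le ht]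
    have := sub_pos.2 hst
    positivity
  obtain ⟨c, hc, -, S, _, Q, _, ξ, hG, hX⟩ := hX
  have h1 := tendsto_integral_prod_increments hα hb hc hT hG hX (fun _ : Fin 1 => s) (fun _ => t)
    (fun _ => hs) (fun _ => hst.le) (fun _ => ht) (fun _ => 1)
  have hk := tendsto_integral_prod_increments hα hb hc hT hG hX (fun _ : Fin 1 => s) (fun _ => t)
    (fun _ => hs) (fun _ => hst.le) (fun _ => ht) (fun _ => k)
  simp only [Finset.univ_unique, Finset.prod_singleton, Finset.sum_singleton, pow_one] at h1 hk
  have hle := le_of_tendsto_of_tendsto' (h1.pow k) hk fun n => ?_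
  · rw [mul_pow] at hle
    have hKpos : 0 < (c * Real.Gamma α) ^ k := by positivity
    exact (pow_pos hmean k).trans_le (le_of_mul_le_mul_left hle hKpos)
  · rw [div_pow]
    refine div_le_div_of_nonneg_right ?_ (by positivity)
    have hI : Finset.Ioc ⌊(n : ℝ) * s⌋₊ ⌊(n : ℝ) * t⌋₊ ⊆ _ := Ioc_floor_subset ht
    have hbd : ∀ j : ℕ, Integrable (fun ω => (∑ i ∈ Finset.Ioc ⌊(n : ℝ) * s⌋₊ ⌊(n : ℝ) * t⌋₊,
        ξ n i ω) ^ j) (Q n) := by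
      intro j
      refine Integrable.of_bound (((hG n).measurable_sum hI).pow_const j).aestronglyMeasurable
        ((Finset.Ioc ⌊(n : ℝ) * s⌋₊ ⌊(n : ℝ) * t⌋₊).card ^ j) (ae_of_all _ fun ω => ?_)
      rw [Real.norm_of_nonneg (pow_nonneg ((hG n).sum_nonneg hI ω) _)]
      exact pow_le_pow_left₀ ((hG n).sum_nonneg hI ω) ((hG n).sum_le hI ω) j
    exact (convexOn_pow k).map_integral_le (continuousOn_pow k) isClosed_Ici
      (ae_of_all _ fun ω => (hG n).sum_nonneg hI ω) (by simpa using hbd 1) (hbd k)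

end IsMittagLefflerProcess

end Moments

/-! ### Second differences of powers. -/

section Calculus

/-- The second symmetric difference of a power function. -/
lemma tendsto_second_difference_rpow {p h : ℝ} (hh : 0 < h) :
    Tendsto (fun d : ℝ => ((h + d) ^ p + (h - d) ^ p - 2 * h ^ p) / d ^ 2) (𝓝[>] 0)
      (𝓝 (p * (p - 1) * h ^ (p - 2))) := by
  have hder : ∀ q : ℝ, ∀ d ∈ Set.Ioo (-h) h, HasDerivAt (fun d : ℝ => (h + d) ^ q)
      (q * (h + d) ^ (q - 1)) d ∧ HasDerivAt (fun d : ℝ => (h - d) ^ q)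
      (-(q * (h - d) ^ (q - 1))) d := by
    intro q d hd
    have h1 : h + d ≠ 0 := by linarith [hd.1]
    have h2 : h - d ≠ 0 := by linarith [hd.2]
    constructor
    · simpa using ((hasDerivAt_id d).const_add h).rpow_const (p := q) (Or.inl h1)
    · simpa using ((hasDerivAt_id d).const_sub h).rpow_const (p := q) (Or.inl h2)
  have hIoo : Set.Ioo 0 h ⊆ Set.Ioo (-h) h := Set.Ioo_subset_Ioo_left (by linarith)
  have h0 : (0 : ℝ) ∈ Set.Ioo (-h) h := ⟨by linarith, hh⟩
  refine HasDerivAt.lhopital_zero_nhdsGT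
    (f' := fun d => p * (h + d) ^ (p - 1) + -(p * (h - d) ^ (p - 1)))
    (g' := fun d => 2 * d) ?_ ?_ ?_ ?_ ?_ ?_
  · filter_upwards [Ioo_mem_nhdsGT hh] with d hd
    exact ((hder p d (hIoo hd)).1.add (hder p d (hIoo hd)).2).sub_const _
  · filter_upwards with d
    simpa using hasDerivAt_pow 2 d
  · filter_upwards [self_mem_nhdsWithin] with d hd
    have : 0 < d := hd
    positivity
  · have hc := (((hder p 0 h0).1.add (hder p 0 h0).2).sub_const (2 * h ^ p)).continuousAt.tendsto
    simp only [Pi.add_apply, add_zero, sub_zero] at hc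
    rw [show h ^ p + h ^ p - 2 * h ^ p = 0 by ring] at hc
    exact hc.mono_left nhdsWithin_le_nhds
  · have : Tendsto (fun d : ℝ => d ^ 2) (𝓝 0) (𝓝 (0 ^ 2)) := (continuous_pow 2).tendsto 0
    rw [zero_pow two_ne_zero] at this
    exact this.mono_left nhdsWithin_le_nhds
  -- After one use of l'Hôpital's rule the quotient is half a difference quotient at zero of `p ((h
  -- + d) ^ (p - 1) - (h - d) ^ (p - 1))`, so a derivative finishes the limit.
  · have hc := (((hder (p - 1) 0 h0).1.sub
      (hder (p - 1) 0 h0).2).const_mul p).tendsto_slope_zero_right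
    convert hc.div_const 2 using 2
    · simp only [Pi.sub_apply, zero_add, add_zero, sub_zero, sub_self, smul_eq_mul]
      ring
    · rw [add_zero, sub_zero, show p - 1 - 1 = p - 2 by ring]
      ring

lemma isEquivalent_mul_const {ι : Type*} {l : Filter ι} {u v : ι → ℝ} {L : ℝ}
    (h : Tendsto (fun x => u x / v x) l (𝓝 L)) (hL : L ≠ 0) (hv : ∀ᶠ x in l, v x ≠ 0) :
    u ~[l] fun x => v x * L := by
  have h1 := (IsEquivalent.refl (u := v) (l := l)).mul ((isEquivalent_const_iff_tendsto hL).2 h)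
  refine h1.congr_left ?_
  filter_upwards [hv] with x hx
  simp only [Pi.mul_apply]
  field_simp

end Calculus

/-! ### Exact second-order structure of the increments. -/

section SecondMoments

variable {Ω : Type*} [MeasurableSpace Ω] {P : Measure Ω} [IsProbabilityMeasure P]
  {α b T : ℝ} {X : ℝ → Ω → ℝ}

lemma Gamma_add_two {α : ℝ} (hα : 0 < α) :
    Real.Gamma (α + 2) = (α + 1) * α * Real.Gamma α := by
  rw [show α + 2 = (α + 1) + 1 by ring, Real.Gamma_add_one (by linarith),
    Real.Gamma_add_one hα.ne']
  ring

namespace IsMittagLefflerProcess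

lemma memLp_two (hX : IsMittagLefflerProcess P α b T X) (hα : α ∈ Set.Ioo (0 : ℝ) 1) (hb : 0 < b)
    (hT : 0 < T) {t : ℝ} (ht : t ∈ Set.Icc 0 T) : MemLp (X t) 2 P := by
  exact_mod_cast hX.memLp hα hb hT ht 2

lemma memLp_two_increment (hX : IsMittagLefflerProcess P α b T X) (hα : α ∈ Set.Ioo (0 : ℝ) 1)
    (hb : 0 < b) (hT : 0 < T) {d t : ℝ} (hd : 0 ≤ d) (hdt : d ≤ t) (ht : t ≤ T) :
    MemLp (increment X d t) 2 P :=
  (hX.memLp_two hα hb hT ⟨hd.trans hdt, ht⟩).sub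
    (hX.memLp_two hα hb hT ⟨sub_nonneg.2 hdt, by linarith⟩)

lemma integral_sub_sq (hX : IsMittagLefflerProcess P α b T X) (hα : α ∈ Set.Ioo (0 : ℝ) 1)
    (hb : 0 < b) (hT : 0 < T) {x y : ℝ} (hx : x ∈ Set.Icc 0 T) (hy : y ∈ Set.Icc 0 T) :
    ∫ ω, (X x ω - X y ω) ^ 2 ∂P
      = 2 * (b * T ^ (α - 1) / (Real.Gamma α * Real.Gamma (α + 2))) * |x - y| ^ (α + 1) := by
  have hp : α + 1 ≠ 0 := by linarith [hα.1]
  rcases lt_trichotomy x y with h | rfl | h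
  · rw [abs_sub_comm, abs_of_pos (sub_pos.2 h), ← hX.integral_increment_sq hα hb hT hx.1 h hy.2]
    congr 1; ext ω; ring
  · simp [Real.zero_rpow hp]
  · rw [abs_of_pos (sub_pos.2 h), ← hX.integral_increment_sq hα hb hT hy.1 h hx.2]

/-- Polarisation: a product of two differences is a combination of four squared differences. No
disjointness of the two time intervals is needed. -/
lemma integral_sub_mul_sub (hX : IsMittagLefflerProcess P α b T X) (hα : α ∈ Set.Ioo (0 : ℝ) 1)
    (hb : 0 < b) (hT : 0 < T) {x y z w : ℝ} (hx : x ∈ Set.Icc 0 T) (hy : y ∈ Set.Icc 0 T)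
    (hz : z ∈ Set.Icc 0 T) (hw : w ∈ Set.Icc 0 T) :
    ∫ ω, (X x ω - X y ω) * (X z ω - X w ω) ∂P
      = b * T ^ (α - 1) / (Real.Gamma α * Real.Gamma (α + 2)) *
        (|x - w| ^ (α + 1) + |y - z| ^ (α + 1) - |x - z| ^ (α + 1) - |y - w| ^ (α + 1)) := by
  have hi : ∀ {u v : ℝ}, u ∈ Set.Icc 0 T → v ∈ Set.Icc 0 T →
      Integrable (fun ω => (X u ω - X v ω) ^ 2) P := fun hu hv =>
    ((hX.memLp_two hα hb hT hu).sub (hX.memLp_two hα hb hT hv)).integrable_sq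
  have e : ∀ ω, (X x ω - X y ω) * (X z ω - X w ω)
      = 2⁻¹ * ((X x ω - X w ω) ^ 2 + (X y ω - X z ω) ^ 2
        - ((X x ω - X z ω) ^ 2 + (X y ω - X w ω) ^ 2)) := fun ω => by ring
  have i1 := integral_add (hi hx hw) (hi hy hz)
  have i2 := integral_add (hi hx hz) (hi hy hw)
  have i3 := integral_sub ((hi hx hw).add (hi hy hz)) ((hi hx hz).add (hi hy hw))
  simp only [Pi.add_apply] at i3
  simp_rw [e]
  rw [integral_const_mul, i3, i1, i2, hX.integral_sub_sq hα hb hT hx hw,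
    hX.integral_sub_sq hα hb hT hy hz, hX.integral_sub_sq hα hb hT hx hz,
    hX.integral_sub_sq hα hb hT hy hw]
  ring

/-- The absolute value keeps lags shorter than `d`: the case `s = t` gives the variance, and `s - t
< d` gives the short-lag asymptotics. -/
lemma integral_increment_mul_increment (hX : IsMittagLefflerProcess P α b T X)
    (hα : α ∈ Set.Ioo (0 : ℝ) 1) (hb : 0 < b) (hT : 0 < T) {d t s : ℝ} (hd : 0 ≤ d) (hdt : d ≤ t)
    (hts : t ≤ s) (hs : s ≤ T) :
    ∫ ω, increment X d t ω * increment X d s ω ∂P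
      = b * T ^ (α - 1) / (Real.Gamma α * Real.Gamma (α + 2)) *
        ((s - t + d) ^ (α + 1) - 2 * (s - t) ^ (α + 1) + |s - t - d| ^ (α + 1)) := by
  have h := hX.integral_sub_mul_sub hα hb hT (x := t) (y := t - d) (z := s) (w := s - d)
    ⟨by linarith, by linarith⟩ ⟨by linarith, by linarith⟩ ⟨by linarith, by linarith⟩
    ⟨by linarith, by linarith⟩
  rw [show t - (s - d) = -(s - t - d) by ring, show t - d - s = -(s - t + d) by ring,
    show t - s = -(s - t) by ring, show t - d - (s - d) = -(s - t) by ring] at h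
  simp only [abs_neg] at h
  rw [abs_of_nonneg (by linarith : 0 ≤ s - t + d), abs_of_nonneg (by linarith : 0 ≤ s - t)] at h
  refine h.trans ?_
  ring

lemma integral_increment_eq (hX : IsMittagLefflerProcess P α b T X) (hα : α ∈ Set.Ioo (0 : ℝ) 1)
    (hb : 0 < b) (hT : 0 < T) {d t : ℝ} (hd : 0 ≤ d) (hdt : d ≤ t) (ht : t ≤ T) :
    ∫ ω, increment X d t ω ∂P = b * T ^ (α - 1) / Real.Gamma α * d := by
  have := hX.integral_increment hα hb hT (sub_nonneg.2 hdt) (sub_le_self t hd) ht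
  rw [sub_sub_cancel] at this
  exact this

lemma covariance_increment (hX : IsMittagLefflerProcess P α b T X) (hα : α ∈ Set.Ioo (0 : ℝ) 1)
    (hb : 0 < b) (hT : 0 < T) {d t s : ℝ} (hd : 0 ≤ d) (hdt : d ≤ t) (hts : t ≤ s) (hs : s ≤ T) :
    covariance (increment X d t) (increment X d s) P
      = b * T ^ (α - 1) / (Real.Gamma α * Real.Gamma (α + 2)) *
        ((s - t + d) ^ (α + 1) - 2 * (s - t) ^ (α + 1) + |s - t - d| ^ (α + 1))
        - (b * T ^ (α - 1) / Real.Gamma α * d) ^ 2 := by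
  rw [covariance_eq_sub (hX.memLp_two_increment hα hb hT hd hdt (hts.trans hs))
    (hX.memLp_two_increment hα hb hT hd (hdt.trans hts) hs),
    hX.integral_increment_eq hα hb hT hd hdt (hts.trans hs),
    hX.integral_increment_eq hα hb hT hd (hdt.trans hts) hs,
    ← hX.integral_increment_mul_increment hα hb hT hd hdt hts hs, sq]
  rfl

lemma variance_increment (hX : IsMittagLefflerProcess P α b T X) (hα : α ∈ Set.Ioo (0 : ℝ) 1)
    (hb : 0 < b) (hT : 0 < T) {d t : ℝ} (hd : 0 < d) (hdt : d ≤ t) (ht : t ≤ T) :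
    variance (increment X d t) P
      = d ^ 2 * (b * T ^ (α - 1) / Real.Gamma α ^ 2) *
        (2 / (α * (α + 1)) * d ^ (α - 1) - b * T ^ (α - 1)) := by
  have hα0 := hα.1
  have hΓ := Real.Gamma_pos_of_pos hα0
  rw [← covariance_self (hX.memLp_two_increment hα hb hT hd.le hdt ht).aemeasurable,
    hX.covariance_increment hα hb hT hd.le hdt le_rfl ht, Gamma_add_two hα0]
  rw [sub_self, zero_add, zero_sub, abs_neg, abs_of_pos hd, Real.zero_rpow (by linarith),
    Real.rpow_add_one hd.ne', Real.rpow_sub_one hd.ne']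
  field_simp
  ring

lemma variance_increment_pos (hX : IsMittagLefflerProcess P α b T X) (hα : α ∈ Set.Ioo (0 : ℝ) 1)
    (hb : b ∈ Set.Ioc (0 : ℝ) 1) (hT : 0 < T) {d t : ℝ} (hd : 0 < d) (hdt : d ≤ t) (ht : t ≤ T) :
    0 < variance (increment X d t) P := by
  have hα0 := hα.1
  have hb0 := hb.1
  have hΓ := Real.Gamma_pos_of_pos hα0
  rw [hX.variance_increment hα hb.1 hT hd hdt ht]
  have h1 : T ^ (α - 1) ≤ d ^ (α - 1) :=
    Real.rpow_le_rpow_of_nonpos hd (hdt.trans ht) (by linarith [hα.2])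
  have h2 : b * T ^ (α - 1) ≤ T ^ (α - 1) :=
    mul_le_of_le_one_left (Real.rpow_nonneg hT.le _) hb.2
  -- Since `d ≤ T` and `b ≤ 1` only give `b T ^ (α - 1) ≤ d ^ (α - 1)`, the strictness of the
  -- variance bound comes from this constant.
  have h3 : 1 < 2 / (α * (α + 1)) := by
    rw [lt_div_iff₀ (by positivity)]; nlinarith [hα.2]
  have h4 : 0 < d ^ (α - 1) := Real.rpow_pos_of_pos hd _
  have h5 : 0 < 2 / (α * (α + 1)) * d ^ (α - 1) - b * T ^ (α - 1) := by nlinarith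
  positivity

/-- The variance of an increment depends only on `d`, so the two square roots in the denominator
coincide. -/
lemma correlation_increment (hX : IsMittagLefflerProcess P α b T X) (hα : α ∈ Set.Ioo (0 : ℝ) 1)
    (hb : 0 < b) (hT : 0 < T) {d t s : ℝ} (hd : 0 < d) (hdt : d ≤ t) (hts : t ≤ s) (hs : s ≤ T) :
    correlation P (increment X d t) (increment X d s)
      = covariance (increment X d t) (increment X d s) P / variance (increment X d t) P := by
  rw [correlation, hX.variance_increment hα hb hT hd (hdt.trans hts) hs,
    ← hX.variance_increment hα hb hT hd hdt (hts.trans hs),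
    Real.mul_self_sqrt (variance_nonneg _ _)]

end IsMittagLefflerProcess

end SecondMoments

/-! ### Asymptotics for small steps and short lags, and ratios of mixed moments. -/

lemma tendsto_second_difference_rpow_add_one {α h : ℝ} (hh : 0 < h) :
    Tendsto (fun d : ℝ => ((h + d) ^ (α + 1) + (h - d) ^ (α + 1) - 2 * h ^ (α + 1)) / d ^ 2)
      (𝓝[>] 0) (𝓝 ((α + 1) * α * h ^ (α - 1))) := by
  have := tendsto_second_difference_rpow (p := α + 1) hh
  rwa [add_sub_cancel_right, show α + 1 - 2 = α - 1 by ring] at this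

namespace IsMittagLefflerProcess

variable {Ω : Type*} [MeasurableSpace Ω] {P : Measure Ω} [IsProbabilityMeasure P]
  {α b T : ℝ} {X : ℝ → Ω → ℝ}

lemma tendsto_integral_increment_mul_increment_div (hX : IsMittagLefflerProcess P α b T X)
    (hα : α ∈ Set.Ioo (0 : ℝ) 1) (hb : 0 < b) (hT : 0 < T) {t s : ℝ} (ht : 0 < t) (hts : t < s)
    (hs : s ≤ T) :
    Tendsto (fun d : ℝ => (∫ ω, increment X d t ω * increment X d s ω ∂P) / d ^ 2) (𝓝[>] 0)
      (𝓝 (b * T ^ (α - 1) / Real.Gamma α ^ 2 * (s - t) ^ (α - 1))) := by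
  have hα0 := hα.1
  have hΓ := Real.Gamma_pos_of_pos hα0
  have h := (tendsto_second_difference_rpow_add_one (α := α) (sub_pos.2 hts)).const_mul
    (b * T ^ (α - 1) / (Real.Gamma α * Real.Gamma (α + 2)))
  have e : b * T ^ (α - 1) / (Real.Gamma α * Real.Gamma (α + 2)) *
      ((α + 1) * α * (s - t) ^ (α - 1))
      = b * T ^ (α - 1) / Real.Gamma α ^ 2 * (s - t) ^ (α - 1) := by
    rw [Gamma_add_two hα0]; field_simp
  rw [e] at h
  refine h.congr' ?_
  filter_upwards [Ioo_mem_nhdsGT (lt_min ht (sub_pos.2 hts))] with d hd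
  have hd1 := hd.2.trans_le (min_le_left _ _)
  have hd2 := hd.2.trans_le (min_le_right _ _)
  rw [hX.integral_increment_mul_increment hα hb hT hd.1.le hd1.le hts.le hs,
    abs_of_pos (by linarith)]
  ring

lemma integral_increment_isEquivalent (hX : IsMittagLefflerProcess P α b T X)
    (hα : α ∈ Set.Ioo (0 : ℝ) 1) (hb : 0 < b) (hT : 0 < T) {t s : ℝ} (ht : 0 < t) (hts : t < s)
    (hs : s ≤ T) :
    (fun d : ℝ => ∫ ω, increment X d t ω * increment X d s ω ∂P) ~[𝓝[>] 0]
        fun d => d ^ 2 * (b * T ^ (α - 1) / Real.Gamma α ^ 2) * (s - t) ^ (α - 1) := by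
  have hΓ := Real.Gamma_pos_of_pos hα.1
  have hst := sub_pos.2 hts
  have h := isEquivalent_mul_const
    (hX.tendsto_integral_increment_mul_increment_div hα hb hT ht hts hs) (by positivity)
    (by filter_upwards [self_mem_nhdsWithin] with d hd; exact (pow_pos hd 2).ne')
  simpa only [mul_assoc] using h

/-- Makes the limiting constant of the covariance nonzero, without which the limit would not give an
asymptotic equivalence. -/
lemma rpow_sub_pos (hα : α ∈ Set.Ioo (0 : ℝ) 1) (hb : b ∈ Set.Ioc (0 : ℝ) 1)
    {h : ℝ} (hh : 0 < h) (hhT : h < T) : 0 < h ^ (α - 1) - b * T ^ (α - 1) := by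
  have h1 : T ^ (α - 1) < h ^ (α - 1) := Real.rpow_lt_rpow_of_neg hh hhT (by linarith [hα.2])
  have h2 : b * T ^ (α - 1) ≤ T ^ (α - 1) :=
    mul_le_of_le_one_left (Real.rpow_nonneg (hh.trans hhT).le _) hb.2
  linarith

lemma covariance_increment_isEquivalent (hX : IsMittagLefflerProcess P α b T X)
    (hα : α ∈ Set.Ioo (0 : ℝ) 1) (hb : b ∈ Set.Ioc (0 : ℝ) 1) (hT : 0 < T) {t s : ℝ} (ht : 0 < t)
    (hts : t < s) (hs : s ≤ T) :
    (fun d : ℝ => covariance (increment X d t) (increment X d s) P) ~[𝓝[>] 0]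
        fun d => d ^ 2 * (b * T ^ (α - 1) / Real.Gamma α ^ 2) *
          ((s - t) ^ (α - 1) - b * T ^ (α - 1)) := by
  have hΓ := Real.Gamma_pos_of_pos hα.1
  have hb0 := hb.1
  have hpos := rpow_sub_pos hα hb (sub_pos.2 hts) (by linarith : s - t < T)
  have hlim := (hX.tendsto_integral_increment_mul_increment_div hα hb.1 hT ht hts hs).sub_const
    ((b * T ^ (α - 1) / Real.Gamma α) ^ 2)
  have e : b * T ^ (α - 1) / Real.Gamma α ^ 2 * (s - t) ^ (α - 1)
      - (b * T ^ (α - 1) / Real.Gamma α) ^ 2 = b * T ^ (α - 1) / Real.Gamma α ^ 2 *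
      ((s - t) ^ (α - 1) - b * T ^ (α - 1)) := by
    field_simp
  rw [e] at hlim
  have h := isEquivalent_mul_const
    (u := fun d : ℝ => covariance (increment X d t) (increment X d s) P) (v := fun d : ℝ => d ^ 2)
    (hlim.congr' ?_) (by positivity)
    (by filter_upwards [self_mem_nhdsWithin] with d hd; exact (pow_pos hd 2).ne')
  · simpa only [mul_assoc] using h
  · filter_upwards [Ioo_mem_nhdsGT ht] with d hd
    have hd0 := hd.1.ne'
    rw [hX.covariance_increment hα hb.1 hT hd.1.le hd.2.le hts.le hs,
      hX.integral_increment_mul_increment hα hb.1 hT hd.1.le hd.2.le hts.le hs, mul_pow]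
    field_simp

lemma correlation_increment_isEquivalent (hX : IsMittagLefflerProcess P α b T X)
    (hα : α ∈ Set.Ioo (0 : ℝ) 1) (hb : b ∈ Set.Ioc (0 : ℝ) 1) (hT : 0 < T) {t s : ℝ} (ht : 0 < t)
    (hts : t < s) (hs : s ≤ T) :
    (fun d : ℝ => correlation P (increment X d t) (increment X d s)) ~[𝓝[>] 0]
        fun d => ((s - t) ^ (α - 1) - b * T ^ (α - 1)) /
          (2 / (α * (α + 1)) * d ^ (α - 1) - b * T ^ (α - 1)) := by
  have hΓ := Real.Gamma_pos_of_pos hα.1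
  have hb0 := hb.1
  refine (((hX.covariance_increment_isEquivalent hα hb hT ht hts hs).div
    (IsEquivalent.refl (u := fun d => variance (increment X d t) P))).congr_left ?_).congr_right ?_
  · filter_upwards [Ioo_mem_nhdsGT ht] with d hd
    exact (hX.correlation_increment hα hb.1 hT hd.1 hd.2.le hts.le hs).symm
  · filter_upwards [Ioo_mem_nhdsGT ht] with d hd
    have hd0 := hd.1
    simp only [Pi.div_apply]
    rw [hX.variance_increment hα hb.1 hT hd.1 hd.2.le (hts.le.trans hs)]
    exact mul_div_mul_left _ _ (by positivity)

/-- The pairs `(t, s)` with `d ≤ t` and `s ≤ T` as `s - t` decreases to `0`. -/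
lemma eventually_short_lag {d : ℝ} (hd : 0 < d) :
    ∀ᶠ p : ℝ × ℝ in comap (fun p : ℝ × ℝ => p.2 - p.1) (𝓝[>] 0) ⊓ 𝓟 {p | d ≤ p.1 ∧ p.2 ≤ T},
      0 < p.2 - p.1 ∧ p.2 - p.1 < d ∧ d ≤ p.1 ∧ p.2 ≤ T := by
  have h1 : ∀ᶠ p : ℝ × ℝ in comap (fun p : ℝ × ℝ => p.2 - p.1) (𝓝[>] 0),
      p.2 - p.1 ∈ Set.Ioo 0 d := tendsto_comap.eventually (Ioo_mem_nhdsGT hd)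
  filter_upwards [h1.filter_mono inf_le_left, mem_inf_of_right (mem_principal_self _)] with p hp hp'
  exact ⟨hp.1, hp.2, hp'⟩

lemma one_sub_correlation_isEquivalent (hX : IsMittagLefflerProcess P α b T X)
    (hα : α ∈ Set.Ioo (0 : ℝ) 1) (hb : b ∈ Set.Ioc (0 : ℝ) 1) (hT : 0 < T) {d : ℝ} (hd : 0 < d) :
    (fun p : ℝ × ℝ => 1 - correlation P (increment X d p.1) (increment X d p.2))
        ~[comap (fun p : ℝ × ℝ => p.2 - p.1) (𝓝[>] 0) ⊓ 𝓟 {p | d ≤ p.1 ∧ p.2 ≤ T}]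
        fun p => 2 * b * T ^ (α - 1) /
          (Real.Gamma α * Real.Gamma (α + 2) * variance (increment X d p.1) P) *
            (p.2 - p.1) ^ (α + 1) := by
  have hα0 := hα.1
  have hΓ := Real.Gamma_pos_of_pos hα0
  have hΓ2 := Real.Gamma_pos_of_pos (by linarith : 0 < α + 2)
  set l := comap (fun p : ℝ × ℝ => p.2 - p.1) (𝓝[>] 0) ⊓ 𝓟 {p | d ≤ p.1 ∧ p.2 ≤ T}
  have hl : Tendsto (fun p : ℝ × ℝ => p.2 - p.1) l (𝓝[>] 0) := tendsto_comap.mono_left inf_le_left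
  -- For lag `h < d` the numerator is the variance minus the covariance, up to a constant. The
  -- second difference around `d` is of order `h ^ 2`, negligible against `h ^ (α + 1)` because `α <
  -- 1`.
  have hψ : Tendsto (fun h : ℝ => (2 * h ^ (α + 1)
      - ((d + h) ^ (α + 1) + (d - h) ^ (α + 1) - 2 * d ^ (α + 1))) / h ^ (α + 1)) (𝓝[>] 0)
      (𝓝 2) := by
    have h1 := tendsto_second_difference_rpow_add_one (α := α) hd
    have h2 : Tendsto (fun h : ℝ => h ^ (1 - α)) (𝓝[>] 0) (𝓝 0) := by
      have := (Real.continuousAt_rpow_const 0 (1 - α) (Or.inr (by linarith [hα.2]))).tendsto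
      rw [Real.zero_rpow (by linarith [hα.2])] at this
      exact this.mono_left nhdsWithin_le_nhds
    have h3 := (h1.mul h2).const_sub 2
    rw [mul_zero, sub_zero] at h3
    refine h3.congr' ?_
    filter_upwards [self_mem_nhdsWithin] with h hh
    have hh0 : 0 < h := hh
    rw [show 1 - α = 2 - (α + 1) by ring, Real.rpow_sub hh0, Real.rpow_two]
    have : 0 < h ^ (α + 1) := by positivity
    field_simp
  have hequiv := isEquivalent_mul_const hψ two_ne_zero (by
    filter_upwards [self_mem_nhdsWithin] with h hh
    exact (Real.rpow_pos_of_pos hh _).ne')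
  have hmul := ((hequiv.comp_tendsto hl).mul (IsEquivalent.refl
    (u := fun p : ℝ × ℝ => b * T ^ (α - 1) /
      (Real.Gamma α * Real.Gamma (α + 2) * variance (increment X d p.1) P))))
  refine (hmul.congr_left ?_).congr_right ?_
  · filter_upwards [eventually_short_lag (T := T) hd] with p hp
    obtain ⟨hp1, hp2, hp3, hp4⟩ := hp
    have hV := hX.variance_increment_pos hα hb hT hd hp3 (by linarith : p.1 ≤ T)
    have hv := hX.covariance_increment hα hb.1 hT hd.le hp3 le_rfl (by linarith : p.1 ≤ T)
    rw [covariance_self (hX.memLp_two_increment hα hb.1 hT hd.le hp3 (by linarith)).aemeasurable,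
      sub_self, zero_add, zero_sub, abs_neg, abs_of_pos hd, Real.zero_rpow (by linarith)] at hv
    have hc := hX.covariance_increment hα hb.1 hT hd.le hp3 (sub_pos.1 hp1).le hp4
    rw [abs_sub_comm, abs_of_pos (by linarith : 0 < d - (p.2 - p.1)), add_comm _ d] at hc
    rw [hX.correlation_increment hα hb.1 hT hd hp3 (by linarith) hp4, one_sub_div hV.ne']
    have hdiff := congrArg₂ (· - ·) hv hc
    simp only [Pi.mul_apply, Function.comp_apply] at hdiff ⊢
    rw [hdiff, eq_div_iff hV.ne']
    field_simp
    ring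
  · filter_upwards with p
    simp only [Pi.mul_apply, Function.comp_apply]
    ring

/-- Both sides tend to `1`, so this follows from the sharper equivalence for `1 -` the correlation.
-/
lemma correlation_isEquivalent_one_sub (hX : IsMittagLefflerProcess P α b T X)
    (hα : α ∈ Set.Ioo (0 : ℝ) 1) (hb : b ∈ Set.Ioc (0 : ℝ) 1) (hT : 0 < T) {d : ℝ} (hd : 0 < d) :
    (fun p : ℝ × ℝ => correlation P (increment X d p.1) (increment X d p.2))
        ~[comap (fun p : ℝ × ℝ => p.2 - p.1) (𝓝[>] 0) ⊓ 𝓟 {p | d ≤ p.1 ∧ p.2 ≤ T}]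
        fun p => 1 - 2 * b * T ^ (α - 1) /
          (Real.Gamma α * Real.Gamma (α + 2) * variance (increment X d p.1) P) *
            (p.2 - p.1) ^ (α + 1) := by
  have hα0 := hα.1
  have h := hX.one_sub_correlation_isEquivalent hα hb hT hd
  set l := comap (fun p : ℝ × ℝ => p.2 - p.1) (𝓝[>] 0) ⊓ 𝓟 {p | d ≤ p.1 ∧ p.2 ≤ T}
  have hl : Tendsto (fun p : ℝ × ℝ => p.2 - p.1) l (𝓝[>] 0) := tendsto_comap.mono_left inf_le_left
  have hg : Tendsto (fun p : ℝ × ℝ => 2 * b * T ^ (α - 1) /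
          (Real.Gamma α * Real.Gamma (α + 2) * variance (increment X d p.1) P) *
            (p.2 - p.1) ^ (α + 1)) l (𝓝 0) := by
    have h0 : Tendsto (fun h : ℝ => h ^ (α + 1)) (𝓝[>] 0) (𝓝 0) := by
      have := (Real.continuousAt_rpow_const 0 (α + 1) (Or.inr (by linarith))).tendsto
      rw [Real.zero_rpow (by linarith)] at this
      exact this.mono_left nhdsWithin_le_nhds
    -- The variance is written out explicitly so that the coefficient no longer depends on the
    -- moving time `p.1`.
    have h1 := (h0.comp hl).const_mul (2 * b * T ^ (α - 1) / (Real.Gamma α * Real.Gamma (α + 2) *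
      (d ^ 2 * (b * T ^ (α - 1) / Real.Gamma α ^ 2) *
        (2 / (α * (α + 1)) * d ^ (α - 1) - b * T ^ (α - 1)))))
    rw [mul_zero] at h1
    refine h1.congr' ?_
    filter_upwards [eventually_short_lag (T := T) hd] with p hp
    rw [hX.variance_increment hα hb.1 hT hd hp.2.2.1 (by linarith [hp.1, hp.2.2.2])]
    rfl
  have h1 := (isEquivalent_const_iff_tendsto one_ne_zero).2
    (by simpa using (h.symm.tendsto_nhds hg).const_sub 1 : Tendsto (fun p : ℝ × ℝ =>
      correlation P (increment X d p.1) (increment X d p.2)) l (𝓝 1))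
  have h2 := (isEquivalent_const_iff_tendsto one_ne_zero).2
    (by simpa using hg.const_sub 1 : Tendsto (fun p : ℝ × ℝ => 1 - 2 * b * T ^ (α - 1) /
          (Real.Gamma α * Real.Gamma (α + 2) * variance (increment X d p.1) P) *
            (p.2 - p.1) ^ (α + 1)) l (𝓝 1))
  exact h1.trans h2.symm

/-- Once `d` is below every gap, the intervals `[t i - d, t i]` are separated, and the ratio is
squeezed between products with each gap lengthened or shortened by `d`; continuity of the power at
the positive gaps closes the squeeze. -/
lemma tendsto_mixed_moment_ratio (hX : IsMittagLefflerProcess P α b T X)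
    (hα : α ∈ Set.Ioo (0 : ℝ) 1) (hb : 0 < b) (hT : 0 < T) {m : ℕ} {t : Fin (m + 1) → ℝ}
    {k : Fin (m + 1) → ℕ} (ht : StrictMono t) (ht0 : 0 < t 0) (htT : t (Fin.last m) ≤ T)
    (hk : ∀ i, 1 ≤ k i) :
    Tendsto (fun d : ℝ => (∫ ω, ∏ i, increment X d (t i) ω ^ k i ∂P) /
          ∏ i, ∫ ω, increment X d (t i) ω ^ k i ∂P) (𝓝[>] 0)
        (𝓝 (∏ i : Fin m, (t i.succ - t i.castSucc) ^ (α - 1) / (b * T ^ (α - 1)))) := by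
  have hgap : ∀ i : Fin m, 0 < t i.succ - t i.castSucc := fun i =>
    sub_pos.2 (ht i.castSucc_lt_succ)
  have hlim : ∀ ε : ℝ, Tendsto (fun d : ℝ => ∏ i : Fin m,
      (t i.succ - t i.castSucc + ε * d) ^ (α - 1) / (b * T ^ (α - 1))) (𝓝[>] 0)
      (𝓝 (∏ i : Fin m, (t i.succ - t i.castSucc) ^ (α - 1) / (b * T ^ (α - 1)))) := by
    intro ε
    refine tendsto_finsetProd _ fun i _ => ?_
    have h1 : Tendsto (fun d : ℝ => t i.succ - t i.castSucc + ε * d) (𝓝[>] 0)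
        (𝓝 (t i.succ - t i.castSucc)) := by
      have : Tendsto (fun d : ℝ => t i.succ - t i.castSucc + ε * d) (𝓝 0)
          (𝓝 (t i.succ - t i.castSucc + ε * 0)) := (by fun_prop : Continuous _).tendsto 0
      rw [mul_zero, add_zero] at this
      exact this.mono_left nhdsWithin_le_nhds
    exact (h1.rpow_const (Or.inl (hgap i).ne')).div_const _
  have key : ∀ᶠ d : ℝ in 𝓝[>] 0, (∫ ω, ∏ i, increment X d (t i) ω ^ k i ∂P) /
      (∏ i, ∫ ω, increment X d (t i) ω ^ k i ∂P) ∈ Set.Icc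
        (∏ i : Fin m, (t i.succ - t i.castSucc + 1 * d) ^ (α - 1) / (b * T ^ (α - 1)))
        (∏ i : Fin m, (t i.succ - t i.castSucc + (-1) * d) ^ (α - 1) / (b * T ^ (α - 1))) := by
    have hev := eventually_all.2 fun i : Fin m => Ioo_mem_nhdsGT (hgap i)
    filter_upwards [hev, Ioo_mem_nhdsGT ht0] with d hd hd0
    have hs : ∀ j, 0 ≤ t j - d := fun j => by
      have := ht.monotone (Fin.zero_le j)
      linarith [hd0.2]
    have htj : ∀ j, t j ≤ T := fun j => (ht.monotone (Fin.le_last j)).trans htT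
    have h := hX.integral_prod_increments_mem_Icc hα hb hT (s := fun j => t j - d) (t := t)
      hs (fun j => sub_lt_self _ hd0.1) (fun j j' hjj' => by
        have hjm : (j : ℕ) < m := by have := j'.isLt; have : (j : ℕ) < j' := hjj'; omega
        have h1 := (hd ⟨j, hjm⟩).2
        have h2 : t (Fin.succ ⟨j, hjm⟩) ≤ t j' := ht.monotone (by
          rw [Fin.le_def]; exact hjj')
        have h3 : Fin.castSucc ⟨j, hjm⟩ = j := rfl
        rw [h3] at h1
        linarith) (fun j => by linarith [(hd j).2]) htj hk
    have hpos : 0 < ∏ j, ∫ ω, (X (t j) ω - X (t j - d) ω) ^ k j ∂P :=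
      Finset.prod_pos fun j _ =>
        hX.integral_increment_pow_pos hα hb hT (hs j) (sub_lt_self _ hd0.1) (htj j) (k j)
    simp only [increment]
    rw [Set.mem_Icc, le_div_iff₀ hpos, div_le_iff₀ hpos]
    have e1 : ∀ i : Fin m, t i.succ - t i.castSucc + 1 * d = t i.succ - (t i.castSucc - d) :=
      fun i => by ring
    have e2 : ∀ i : Fin m, t i.succ - t i.castSucc + -1 * d = t i.succ - d - t i.castSucc :=
      fun i => by ring
    simp_rw [e1, e2]
    exact h
  exact tendsto_of_tendsto_of_tendsto_of_le_of_le' (hlim 1) (hlim (-1))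
    (key.mono fun d h => h.1) (key.mono fun d h => h.2)

end IsMittagLefflerProcess

theorem proposition3p11 {Ω : Type*} [MeasurableSpace Ω] (P : Measure Ω) [IsProbabilityMeasure P]
    (α b T : ℝ) (hα : α ∈ Set.Ioo (0 : ℝ) 1) (hb : b ∈ Set.Ioc (0 : ℝ) 1) (hT : 0 < T)
    (X : ℝ → Ω → ℝ) (hX : IsMittagLefflerProcess P α b T X) :
    -- all moments are finite, so that the integrals below are genuine
    (∀ t ∈ Set.Icc 0 T, ∀ p : NNReal, MemLp (X t) p P) ∧
    -- second moments of disjoint increments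
    (∀ t s d : ℝ, 0 < d → d ≤ t → d < s - t → s ≤ T →
      ∫ ω, increment X d t ω * increment X d s ω ∂P =
        b * T ^ (α - 1) / (Real.Gamma α * Real.Gamma (α + 2)) *
          ((s - t + d) ^ (α + 1) - 2 * (s - t) ^ (α + 1) + (s - t - d) ^ (α + 1))) ∧
    -- asymptotics of second moment, covariance and correlation as the step `d` tends to `0`
    (∀ t s : ℝ, 0 < t → t < s → s ≤ T →
      ((fun d : ℝ => ∫ ω, increment X d t ω * increment X d s ω ∂P) ~[𝓝[>] 0]
        fun d => d ^ 2 * (b * T ^ (α - 1) / Real.Gamma α ^ 2) * (s - t) ^ (α - 1)) ∧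
      ((fun d : ℝ => covariance (increment X d t) (increment X d s) P) ~[𝓝[>] 0]
        fun d => d ^ 2 * (b * T ^ (α - 1) / Real.Gamma α ^ 2) *
          ((s - t) ^ (α - 1) - b * T ^ (α - 1))) ∧
      ((fun d : ℝ => correlation P (increment X d t) (increment X d s)) ~[𝓝[>] 0]
        fun d => ((s - t) ^ (α - 1) - b * T ^ (α - 1)) /
          (2 / (α * (α + 1)) * d ^ (α - 1) - b * T ^ (α - 1)))) ∧
    -- short-lag asymptotics for a fixed step `d`, as `s - t` decreases to `0`, for pairs `(t, s)`
    -- with `d ≤ t < s ≤ T`: the expansion `1 - c' (s - t) ^ (α + 1)` holds with an error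
    -- `o((s - t) ^ (α + 1))`, and in particular the ratio of the two sides tends to `1`
    (∀ d : ℝ, 0 < d →
      ((fun p : ℝ × ℝ => 1 - correlation P (increment X d p.1) (increment X d p.2))
        ~[comap (fun p : ℝ × ℝ => p.2 - p.1) (𝓝[>] 0) ⊓ 𝓟 {p | d ≤ p.1 ∧ p.2 ≤ T}]
        fun p => 2 * b * T ^ (α - 1) /
          (Real.Gamma α * Real.Gamma (α + 2) * variance (increment X d p.1) P) *
            (p.2 - p.1) ^ (α + 1)) ∧
      ((fun p : ℝ × ℝ => correlation P (increment X d p.1) (increment X d p.2))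
        ~[comap (fun p : ℝ × ℝ => p.2 - p.1) (𝓝[>] 0) ⊓ 𝓟 {p | d ≤ p.1 ∧ p.2 ≤ T}]
        fun p => 1 - 2 * b * T ^ (α - 1) /
          (Real.Gamma α * Real.Gamma (α + 2) * variance (increment X d p.1) P) *
            (p.2 - p.1) ^ (α + 1))) ∧
    -- ratios of mixed moments, for the `m + 1` times `t 0 < ⋯ < t m`
    (∀ (m : ℕ) (t : Fin (m + 1) → ℝ) (k : Fin (m + 1) → ℕ), StrictMono t → 0 < t 0 →
      t (Fin.last m) ≤ T → (∀ i, 1 ≤ k i) →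
      Tendsto (fun d : ℝ => (∫ ω, ∏ i, increment X d (t i) ω ^ k i ∂P) /
          ∏ i, ∫ ω, increment X d (t i) ω ^ k i ∂P) (𝓝[>] 0)
        (𝓝 (∏ i : Fin m, (t i.succ - t i.castSucc) ^ (α - 1) / (b * T ^ (α - 1))))) := by
  refine ⟨fun t ht p => hX.memLp hα hb.1 hT ht p, fun t s d hd hdt hds hs => ?_,
    fun t s ht hts hs => ⟨hX.integral_increment_isEquivalent hα hb.1 hT ht hts hs,
      hX.covariance_increment_isEquivalent hα hb hT ht hts hs,
      hX.correlation_increment_isEquivalent hα hb hT ht hts hs⟩,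
    fun d hd => ⟨hX.one_sub_correlation_isEquivalent hα hb hT hd,
      hX.correlation_isEquivalent_one_sub hα hb hT hd⟩,
    fun m t k ht ht0 htT hk => hX.tendsto_mixed_moment_ratio hα hb.1 hT ht ht0 htT hk⟩
  rw [hX.integral_increment_mul_increment hα hb.1 hT hd.le hdt (by linarith) hs,
    abs_of_pos (by linarith)]
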